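/- Let $F$ be a field of characteristic $0$, let $L$ be an $F$-vector space with basis $e_1,e_2,\dots$, and let $E$ be the infinite dimensional (unital) Grassmann algebra of $L$, with its canonical basis $B_E$ consisting of $1$ and the monomials $e_{i_1}\cdots e_{i_k}$, $i_1<\dots<i_k$, $k\ge 1$; the length of this monomial is $k$ and its support is $\{e_{i_1},\dots,e_{i_k}\}$ (the element $1$ has length $0$ and empty support). For $G=\mathbb Z$ or $G=\mathbb Z_2=\mathbb Z/2\mathbb Z$ let $F\langle X|G\rangle$ be the free unital associative algebra on variables $x_i^g$ ($g\in G$ the degree of the variable, $i$ ranging over a countably infinite set). For a $G$-graded algebra $R=\bigoplus_{g\in G}R_g$ let $T_G(R)\subseteq F\langle X|G\rangle$ be the ideal of its graded polynomial identities, that is, of the polynomials that vanish whenever each variable $x_i^g$ is replaced by an element of $R_g$; write $T_2$ for $T_{\mathbb Z_2}$. A $T_{\mathbb Z}$-ideal is a two-sided ideal of $F\langle X|\mathbb Z\rangle$ stable under all $\mathbb Z$-graded endomorphisms. Let $\pi\colon F\langle X|\mathbb Z\rangle\to F\langle X|\mathbb Z_2\rangle$ be the homomorphism with $\pi(x_i^n)=x_i^{\overline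 n}$. Let $T_{\mathbb Z}(\mathfrak V_1^{\mathbb Z})$ be the $T_{\mathbb Z}$-ideal generated by the polynomials $[x_1,x_2,x_3]=[[x_1,x_2],x_3]$ for all degrees of $x_1,x_2,x_3$, and let $T_{\mathbb Z}(\mathfrak V_2^{\mathbb Z})$ be the $T_{\mathbb Z}$-ideal generated by $[x_1,x_2]$ when the degree of $x_1$ or of $x_2$ is even and $x_1x_2+x_2x_1$ when both degrees are odd. Let $A=\bigoplus_{r\in\mathbb Z}A_r$ be an arbitrary (not necessarily homogeneous) $\mathbb Z$-grading on $E$. 1. Suppose that $S$ is an infinite set of indices such that each $e_i$, $i\in S$, is homogeneous in the grading, let $B$ be the unital subalgebra generated by the $e_i$, $i\in S$, and suppose that the grading $B=\bigoplus_r B_r$, $B_r=B\cap A_r$, is central. This means that every $e_i$, $i\in S$, is homogeneous, that $B_r\ne 0$ for every $r\in\mathbb Z$, and that for every even $h$ the component $B_h$ contains infinitely many elements of $B_E$ of even length, with pairwise disjoint supports contained in $\{e_i\mid i\in S\}$. Let $E_d$ be $B$ with the induced $\mathbb Z_2$-grading, whose components are $\bigoplus_{r\text{ even}}B_r$ and $\bigoplus_{r\text{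 odd}}B_r$. Then $$T_{\mathbb Z}(A)\subseteq\{f\in F\langle X|\mathbb Z\rangle\mid \pi(f)\in T_2(E_d)\}.$$ 2. In particular, suppose that there are integers $m<0<n$ with $\gcd(m,n)=1$ such that $L\cap A_m$ and $L\cap A_n$ are both infinite dimensional (for instance, such that infinitely many $e_i$ lie in $A_m$ and infinitely many in $A_n$). Then one of the following holds: (a) $mn$ is even and $T_{\mathbb Z}(A)=T_{\mathbb Z}(\mathfrak V_1^{\mathbb Z})$; or (b) $mn$ is odd and $T_{\mathbb Z}(A)\subseteq T_{\mathbb Z}(\mathfrak V_2^{\mathbb Z})$. -/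

import Mathlib

namespace GradedGrassmann

section FreeAlg

variable (F : Type*) [Field F] {G : Type*} [AddCommGroup G]

/-- The free associative unital algebra on the variables `x_i^g`, where `g : G` is the degree of the
variable and `i : ℕ` is its index. -/
abbrev FreeGr (F : Type*) [Field F] (G : Type*) : Type _ := FreeAlgebra F (G × ℕ)

/-- The variable `x_i^g`. -/
noncomputable def X (g : G) (i : ℕ) : FreeGr F G := FreeAlgebra.ι F (g, i)

/-- The homogeneous component of degree `g` of the free algebra: the span of all words whose
letters have degrees adding up to `g`. -/
noncomputable def freeComponent (g : G) : Submodule F (FreeGr F G) :=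
  Submodule.span F
    {f | ∃ w : List (G × ℕ), (w.map Prod.fst).sum = g ∧ f = (w.map (FreeAlgebra.ι F)).prod}

/-- Graded endomorphisms of the free algebra. -/
def IsGradedEndo (φ : FreeGr F G →ₐ[F] FreeGr F G) : Prop :=
  ∀ g : G, ∀ f ∈ freeComponent F g, φ f ∈ freeComponent F g

/-- A `T_G`-ideal: a two-sided ideal stable under all graded endomorphisms. -/
def IsTIdeal (I : TwoSidedIdeal (FreeGr F G)) : Prop :=
  ∀ φ : FreeGr F G →ₐ[F] FreeGr F G, IsGradedEndo F φ → ∀ f ∈ I, φ f ∈ I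

/-- The `T_G`-ideal generated by a set of graded polynomials. This is the ideal of graded
identities of the variety of `G`-graded algebras defined by the set. -/
noncomputable def tIdealSpan (s : Set (FreeGr F G)) : TwoSidedIdeal (FreeGr F G) :=
  sInf {I | IsTIdeal F I ∧ ∀ f ∈ s, f ∈ I}

/-- The homomorphism `π` with `π (x_i^n) = x_i^{n mod 2}`. -/
noncomputable def reduceMod2 : FreeGr F ℤ →ₐ[F] FreeGr F (ZMod 2) :=
  FreeAlgebra.lift F fun p : ℤ × ℕ => X F (p.1 : ZMod 2) p.2

/-- The ideal of identities of the variety `𝔙₁` of `ℤ`-graded algebras, defined by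
`[x₁, x₂, x₃] = [[x₁, x₂], x₃]` for all degrees of the variables. -/
noncomputable def identitiesV1 : TwoSidedIdeal (FreeGr F ℤ) :=
  tIdealSpan F {f | ∃ p q r : ℤ, f = ⁅⁅X F p 1, X F q 2⁆, X F r 3⁆}

/-- The ideal of identities of the variety `𝔙₂` of `ℤ`-graded algebras, defined by
`[x₁, x₂]` if one of the degrees is even, and `x₁ x₂ + x₂ x₁` if both degrees are odd. -/
noncomputable def identitiesV2 : TwoSidedIdeal (FreeGr F ℤ) :=
  tIdealSpan F
    ({f | ∃ p q : ℤ, (Even p ∨ Even q) ∧ f = ⁅X F p 1, X F q 2⁆} ∪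
     {f | ∃ p q : ℤ, Odd p ∧ Odd q ∧ f = X F p 1 * X F q 2 + X F q 2 * X F p 1})

end FreeAlg

section Gradings

variable {F : Type*} [Field F] {R : Type*} [Ring R] [Algebra F R]

/-- The ideal `T_G(R)` of graded polynomial identities of an algebra `R` with homogeneous
components `𝒜 g`: the polynomials which vanish under every substitution of the variables `x_i^g`
by elements of `𝒜 g`. -/
noncomputable def gradedIdentities {G : Type*} (𝒜 : G → Submodule F R) : TwoSidedIdeal (FreeGr F G) :=
  ⨅ a : {a : G × ℕ → R // ∀ g i, a (g, i) ∈ 𝒜 g}, TwoSidedIdeal.ker (FreeAlgebra.lift F a.1)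

/-- Membership in `gradedIdentities`. -/
theorem mem_gradedIdentities {G : Type*} (𝒜 : G → Submodule F R) (f : FreeGr F G) :
    f ∈ gradedIdentities 𝒜 ↔
      ∀ a : G × ℕ → R, (∀ g i, a (g, i) ∈ 𝒜 g) → FreeAlgebra.lift F a f = 0 := by
  simp [gradedIdentities, TwoSidedIdeal.mem_iInf, TwoSidedIdeal.mem_ker]

/-- The components `B ∩ A_g` of a subalgebra `B` of a graded algebra, as subspaces of `B`. -/
def restrictGrading {G : Type*} (B : Subalgebra F R) (𝒜 : G → Submodule F R) :
    G → Submodule F B :=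
  fun g => (𝒜 g).comap B.val.toLinearMap

/-- The `ℤ/2ℤ`-grading induced by a `ℤ`-grading: the component of degree `c` is the sum of the
components `𝒜 r` with `r` in the class `c`. -/
def inducedMod2 (𝒜 : ℤ → Submodule F R) : ZMod 2 → Submodule F R :=
  fun c => ⨆ r : {r : ℤ // (r : ZMod 2) = c}, 𝒜 r.1

end Gradings

section Grassmann

variable (F : Type*) [Field F]

/-- The infinite dimensional Grassmann algebra `E` of a vector space with countable basis. -/
abbrev E : Type _ := ExteriorAlgebra F (ℕ →₀ F)

/-- The generator `e_i` of `E`. -/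
noncomputable def e (i : ℕ) : E F := ExteriorAlgebra.ι F (Finsupp.single i 1)

/-- The vector space `L` with basis `e_0, e_1, …`, inside `E`. -/
noncomputable def L : Submodule F (E F) := LinearMap.range (ExteriorAlgebra.ι F)

/-- The canonical basis element `e_{i_1} ⋯ e_{i_k}` (`i_1 < ⋯ < i_k`) whose support is `t`;
its length is `t.card`. -/
noncomputable def basisMonomial (t : Finset ℕ) : E F := ((t.sort (· ≤ ·)).map (e F)).prod

/-- The (unital) subalgebra generated by the `e_i` with `i ∈ S`. -/
noncomputable def subGrassmann (S : Set ℕ) : Subalgebra F (E F) := Algebra.adjoin F (e F '' S)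

variable {F} in
/-- A `ℤ`-grading with components `ℬ r` on the Grassmann algebra generated by the `e_i`, `i ∈ S`,
is central if it is homogeneous (every generator is homogeneous), of full support, and if each
component of even degree contains infinitely many canonical monomials of even length with pairwise
disjoint supports. -/
structure IsCentral (S : Set ℕ) (ℬ : ℤ → Submodule F (subGrassmann F S)) : Prop where
  homogeneous : ∀ i ∈ S, ∃ r : ℤ, ∃ b ∈ ℬ r, (b : E F) = e F i
  full_support : ∀ r : ℤ, ℬ r ≠ ⊥
  central : ∀ h : ℤ, Even h → ∃ T : Set (Finset ℕ), T.Infinite ∧ T.PairwiseDisjoint id ∧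
    ∀ t ∈ T, (t : Set ℕ) ⊆ S ∧ Even t.card ∧ ∃ b ∈ ℬ h, (b : E F) = basisMonomial F t

end Grassmann

end GradedGrassmann

/-! The engine is a degree-changing principle. Suppose that, for every `h` in a set `H` of degrees,
no nonzero `x` is annihilated by all central square-zero elements of degree `h`. Let `f` be a graded
identity and let `b` have degree `r`, where a variable of degree `n` satisfies `n - r ∈ H`. If `v`
is a sum of central square-zero elements of degree `n - r`, then `b * v` is an admissible increment
for that variable. The value of `f` is a polynomial in `v` that vanishes at all such sums. A Taylor
argument in characteristic zero forces this polynomial to be zero, so `v = 1` is allowed too, and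
`b` itself may be substituted. This is `lift_eq_zero_of_mem_gradedIdentities`: `f` vanishes on
substitutions that respect degrees only modulo `H`.

For a central grading, even monomials with disjoint supports supply these elements for all even `h`,
which gives the first claim. In the second, products of an even number of vectors from `L ⊓ A m` and
`L ⊓ A n` supply them: for every `h` if `m * n` is even, and for every even `h` if it is odd.

If `m * n` is even, `f` is therefore an ordinary identity of `E`, and such identities follow from
`[[a, b], c] = 0` (`lift_eq_zero_of_lie_lie`). If `m * n` is odd, even variables may be specialised
to scalars and odd ones to independent vectors of degree `m`; these substitutions separate the free
supercommutative algebra (`lift_eq_zero_of_supercommutative`), so `f` lies in `identitiesV2`. -/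

namespace GradedGrassmann

/-! ### Removing degree constraints with central square-zero elements. -/

section Elimination

/-- First order Taylor expansion at a central square-zero increment. -/
theorem eval_add_of_central_sq_zero {R : Type*} [Ring R] (P : Polynomial R) (v u : R)
    (hu : ∀ y, Commute u y) (hu2 : u * u = 0) :
    P.eval (v + u) = P.eval v + P.derivative.eval v * u := by
  have hpow : ∀ n : ℕ, (v + u) ^ (n + 1) = v ^ (n + 1) + (n + 1 : ℕ) * v ^ n * u := by
    intro n
    induction n with
    | zero => simp
    | succ n ih =>
      rw [pow_succ, ih, mul_add, add_mul, add_mul, mul_assoc _ u u, hu2, mul_zero, add_zero,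
        mul_assoc _ u v, (hu v).eq, pow_succ v (n + 1), add_assoc]
      congr 1
      rw [← mul_assoc, mul_assoc _ (v ^ n), ← pow_succ]
      push_cast
      noncomm_ring
  induction P using Polynomial.induction_on' with
  | add p q hp hq =>
    simp only [Polynomial.eval_add, Polynomial.derivative_add, hp, hq, add_mul]
    abel
  | monomial n a =>
    cases n with
    | zero => simp
    | succ n =>
      rw [Polynomial.derivative_monomial, Polynomial.eval_monomial, Polynomial.eval_monomial,
        Polynomial.eval_monomial, hpow, mul_add]
      simp only [Nat.add_sub_cancel, mul_assoc]

/-- A polynomial which vanishes at all sums of sufficiently many central square-zero elements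
is zero. -/
theorem polynomial_eq_zero_of_eval_closure {R : Type*} [Ring R] [IsAddTorsionFree R] (U : Set R)
    (hc : ∀ u ∈ U, ∀ y, Commute u y) (hsq : ∀ u ∈ U, u * u = 0)
    (hU : ∀ x : R, x ≠ 0 → ∃ u ∈ U, u * x ≠ 0) (P : Polynomial R)
    (hP : ∀ v ∈ AddSubmonoid.closure U, P.eval v = 0) : P = 0 := by
  induction hn : P.natDegree using Nat.strong_induction_on generalizing P with
  | _ n ih =>
    have hd : ∀ v ∈ AddSubmonoid.closure U, P.derivative.eval v = 0 := by
      intro v hv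
      by_contra hne
      obtain ⟨u, hu, hne⟩ := hU _ hne
      have h := eval_add_of_central_sq_zero P v u (hc u hu) (hsq u hu)
      rw [hP v hv, hP _ (add_mem hv (AddSubmonoid.subset_closure hu)), zero_add,
        ← (hc u hu _).eq] at h
      exact hne h.symm
    have h0 : P.natDegree = 0 := by
      by_contra h0
      have := ih _ (hn ▸ Polynomial.natDegree_derivative_lt h0) _ hd rfl
      exact h0 (Polynomial.derivative_eq_zero.1 this)
    have h := hP 0 (zero_mem _)
    rw [Polynomial.eq_C_of_natDegree_eq_zero h0] at h ⊢
    simpa using h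

theorem exists_finset_lift_congr {F : Type*} [Field F] {ι : Type*} (f : FreeAlgebra F ι) :
    ∃ s : Finset ι, ∀ (R : Type*) [Ring R] [Algebra F R] (d d' : ι → R), (∀ i ∈ s, d i = d' i) →
      FreeAlgebra.lift F d f = FreeAlgebra.lift F d' f := by
  classical
  induction f using FreeAlgebra.induction with
  | grade0 r => exact ⟨∅, fun R _ _ d d' _ => by simp⟩
  | grade1 i => exact ⟨{i}, fun R _ _ d d' h => by simpa using h⟩
  | mul a b ha hb =>
    obtain ⟨s, hs⟩ := ha
    obtain ⟨t, ht⟩ := hb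
    refine ⟨s ∪ t, fun R _ _ d d' h => ?_⟩
    rw [map_mul, map_mul, hs R d d' fun i hi => h i (Finset.mem_union_left _ hi),
      ht R d d' fun i hi => h i (Finset.mem_union_right _ hi)]
  | add a b ha hb =>
    obtain ⟨s, hs⟩ := ha
    obtain ⟨t, ht⟩ := hb
    refine ⟨s ∪ t, fun R _ _ d d' h => ?_⟩
    rw [map_add, map_add, hs R d d' fun i hi => h i (Finset.mem_union_left _ hi),
      ht R d d' fun i hi => h i (Finset.mem_union_right _ hi)]

variable {F : Type*} [Field F] {R : Type*} [Ring R] [Algebra F R]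

/-- Evaluation of `R[X]` at a central element is an algebra homomorphism even for noncommutative
`R`, so `v` may be replaced by the indeterminate. -/
theorem exists_polynomial_eval_eq_lift {ι : Type*} [DecidableEq ι] (f : FreeAlgebra F ι)
    (d : ι → R) (p : ι) (b : R) : ∃ P : Polynomial R, ∀ v : R, (∀ y, Commute y v) →
      P.eval v = FreeAlgebra.lift F (d + Pi.single p (b * v)) f := by
  refine ⟨FreeAlgebra.lift F (fun q => Polynomial.C (d q) +
    if q = p then Polynomial.C b * Polynomial.X else 0) f, fun v hv => ?_⟩
  let ψ : Polynomial R →ₐ[F] R :=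
    { Polynomial.eval₂RingHom' (RingHom.id R) v hv with
      commutes' := fun r => by
        simp [Polynomial.algebraMap_apply, Polynomial.eval₂RingHom'] }
  have hψ : ∀ Q, ψ Q = Q.eval v := fun Q => rfl
  have : ψ.comp (FreeAlgebra.lift F (fun q => Polynomial.C (d q) +
      if q = p then Polynomial.C b * Polynomial.X else 0)) =
      FreeAlgebra.lift F (d + Pi.single p (b * v)) := by
    ext q
    by_cases h : q = p
    · subst h
      simp [hψ]
    · simp [hψ, h]
  rw [← this, AlgHom.comp_apply, hψ]

/-- Enlarging degrees: if a graded algebra has enough central square-zero elements of the degrees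
in `H`, then a graded identity vanishes under all substitutions which respect degrees modulo `H`. -/
theorem lift_eq_zero_of_mem_gradedIdentities [CharZero F] {A : ℤ → Submodule F R}
    [SetLike.GradedMonoid A] {H : Set ℤ}
    (hH : ∀ h ∈ H, ∀ x : R, x ≠ 0 → ∃ u ∈ A h, (∀ y, Commute u y) ∧ u * u = 0 ∧ u * x ≠ 0)
    {f : FreeGr F ℤ} (hf : f ∈ gradedIdentities A) (d : ℤ × ℕ → R)
    (hd : ∀ q : ℤ × ℕ, d q ∈ ⨆ r : {r : ℤ // q.1 - r ∈ H}, A r.1) :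
    FreeAlgebra.lift F d f = 0 := by
  have : IsAddTorsionFree R := by
    have := Module.compHom R (algebraMap ℚ F)
    exact IsAddTorsionFree.of_module_rat R
  rw [mem_gradedIdentities] at hf
  -- Quantifying over all homogeneous `a` allows an increment `b * v` of the right degree to be
  -- absorbed into `a`.
  let D : Set (ℤ × ℕ → R) :=
    {d | ∀ a : ℤ × ℕ → R, (∀ q : ℤ × ℕ, a q ∈ A q.1) → FreeAlgebra.lift F (a + d) f = 0}
  have step : ∀ d ∈ D, ∀ (q : ℤ × ℕ) (r : ℤ), q.1 - r ∈ H → ∀ b ∈ A r,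
      d + Pi.single q b ∈ D := by
    intro d hd q r hr b hb a ha
    obtain ⟨P, hP⟩ := exists_polynomial_eval_eq_lift f (a + d) q b
    have hP0 : P = 0 := by
      refine polynomial_eq_zero_of_eval_closure
        {u | u ∈ A (q.1 - r) ∧ (∀ y, Commute u y) ∧ u * u = 0} (fun u hu => hu.2.1)
        (fun u hu => hu.2.2) (fun x hx => ?_) P fun v hv => ?_
      · obtain ⟨u, h1, h2, h3, h4⟩ := hH _ hr x hx
        exact ⟨u, ⟨h1, h2, h3⟩, h4⟩
      · have hv' : v ∈ A (q.1 - r) ∧ ∀ y, Commute y v := by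
          induction hv using AddSubmonoid.closure_induction with
          | mem x hx => exact ⟨hx.1, fun y => (hx.2.1 y).symm⟩
          | zero => exact ⟨zero_mem _, fun y => Commute.zero_right y⟩
          | add x y _ _ hx hy =>
            exact ⟨add_mem hx.1 hy.1, fun z => (hx.2 z).add_right (hy.2 z)⟩
        rw [hP v hv'.2, add_right_comm]
        refine hd _ fun p => ?_
        by_cases hp : p = q
        · subst hp
          have := SetLike.mul_mem_graded hb hv'.1
          rw [add_sub_cancel] at this
          simpa using add_mem (ha p) this
        · simpa [hp] using ha p
    -- The polynomial vanishes identically, so it may be evaluated at `1`, which need not have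
    -- degree `q.1 - r`.
    have := hP 1 fun y => Commute.one_right y
    rw [hP0, Polynomial.eval_zero, mul_one] at this
    rw [← add_assoc, this]
  have step' : ∀ q : ℤ × ℕ, ∀ y ∈ ⨆ r : {r : ℤ // q.1 - r ∈ H}, A r.1, ∀ d ∈ D,
      d + Pi.single q y ∈ D := by
    intro q y hy
    induction hy using Submodule.iSup_induction' with
    | mem r x hx => exact fun d hd => step d hd q r r.2 x hx
    | zero => exact fun d hd => by simpa using hd
    | add x y _ _ hx hy =>
      intro d hd
      rw [Pi.single_add, ← add_assoc]
      exact hy _ (hx d hd)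
  have main : ∀ (s : Finset (ℤ × ℕ)) (d : ℤ × ℕ → R),
      (∀ q : ℤ × ℕ, d q ∈ ⨆ r : {r : ℤ // q.1 - r ∈ H}, A r.1) → (∀ q ∉ s, d q = 0) → d ∈ D := by
    intro s
    induction s using Finset.induction_on with
    | empty =>
      intro d _ h0 a ha
      have : d = 0 := funext fun q => h0 q (Finset.notMem_empty q)
      rw [this, add_zero]
      exact hf a fun g i => ha (g, i)
    | insert p s hp ih =>
      intro d hd h0
      have h1 : Function.update d p 0 + Pi.single p (d p) = d := by
        ext q
        by_cases hq : q = p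
        · subst hq; simp
        · simp [hq]
      rw [← h1]
      refine step' p _ (hd p) _ (ih _ (fun q => ?_) fun q hq => ?_)
      · by_cases hq : q = p
        · subst hq; simp
        · simpa [hq] using hd q
      · by_cases hqp : q = p
        · subst hqp; simp
        · simpa [hqp] using h0 q (by simp [hqp, hq])
  obtain ⟨s, hs⟩ := exists_finset_lift_congr f
  rw [hs R d (fun q => if q ∈ s then d q else 0) fun q hq => by simp [hq]]
  have := main s (fun q => if q ∈ s then d q else 0) (fun q => ?_) (fun q hq => by simp [hq]) 0
    fun q => zero_mem _
  · simpa using this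
  · by_cases hq : q ∈ s
    · simpa [hq] using hd q
    · simp [hq]

end Elimination

/-! ### Supply of central square-zero elements in the Grassmann algebra. -/

section Supply

variable {F : Type*} [Field F]

/-- Only finitely many generators occur in `x`; contractions express this without choosing a basis
of the exterior algebra. -/
theorem exists_finset_contractLeft_eq_zero {σ : Type*} (x : ExteriorAlgebra F (σ →₀ F)) :
    ∃ s : Finset σ, ∀ φ : Module.Dual F (σ →₀ F), (∀ i ∈ s, φ (Finsupp.single i 1) = 0) →
      CliffordAlgebra.contractLeft φ x = 0 := by
  classical
  induction x using CliffordAlgebra.left_induction with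
  | algebraMap r => exact ⟨∅, fun φ _ => CliffordAlgebra.contractLeft_algebraMap _ φ r⟩
  | add x y hx hy =>
    obtain ⟨s, hs⟩ := hx
    obtain ⟨t, ht⟩ := hy
    refine ⟨s ∪ t, fun φ h => ?_⟩
    rw [map_add, hs φ fun i hi => h i (Finset.mem_union_left _ hi),
      ht φ fun i hi => h i (Finset.mem_union_right _ hi), add_zero]
  | ι_mul x m hx =>
    obtain ⟨s, hs⟩ := hx
    refine ⟨s ∪ m.support, fun φ h => ?_⟩
    have hm : φ m = 0 := by
      conv_lhs => rw [← Finsupp.sum_single m]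
      rw [Finsupp.sum, map_sum]
      refine Finset.sum_eq_zero fun i hi => ?_
      rw [← mul_one (m i), ← smul_eq_mul, ← Finsupp.smul_single, map_smul,
        h i (Finset.mem_union_right _ hi), smul_zero]
    rw [CliffordAlgebra.contractLeft_ι_mul, hm,
      hs φ fun i hi => h i (Finset.mem_union_left _ hi), zero_smul, mul_zero, sub_zero]

theorem exists_ι_mul_ne_zero {M : Submodule F (ℕ →₀ F)} (hM : ¬ FiniteDimensional F M)
    {x : E F} (hx : x ≠ 0) : ∃ v ∈ M, ExteriorAlgebra.ι F v * x ≠ 0 := by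
  obtain ⟨s, hs⟩ := exists_finset_contractLeft_eq_zero x
  have : ∃ v ∈ M, ∃ i ∉ s, v i ≠ 0 := by
    by_contra! h
    apply hM
    have hle : M ≤ Finsupp.supported F F (s : Set ℕ) := by
      intro v hv
      rw [Finsupp.mem_supported']
      exact fun i hi => h v hv i hi
    have : FiniteDimensional F (Finsupp.supported F F (s : Set ℕ)) :=
      Module.Finite.equiv (Finsupp.supportedEquivFinsupp (s : Set ℕ)).symm
    exact Submodule.finiteDimensional_of_le hle
  obtain ⟨v, hv, i, hi, hvi⟩ := this
  refine ⟨v, hv, fun h0 => ?_⟩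
  -- Contracting `v * x` with the `i`-th coordinate gives `v i • x`, because that contraction kills
  -- `x`.
  have h := CliffordAlgebra.contractLeft_ι_mul (Q := (0 : QuadraticForm F (ℕ →₀ F)))
    (Finsupp.lapply i) v x
  rw [hs (Finsupp.lapply i) fun j hj => by
    simpa using Finsupp.single_eq_of_ne (by rintro rfl; exact hi hj)] at h
  change CliffordAlgebra.contractLeft _ (ExteriorAlgebra.ι F v * x) = _ at h
  rw [h0, map_zero, mul_zero, sub_zero] at h
  exact smul_ne_zero (by simpa using hvi) hx h.symm

variable {V : Type*} [AddCommGroup V] [Module F V]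

theorem ι_mul_ι_swap (v w : V) :
    ExteriorAlgebra.ι F v * ExteriorAlgebra.ι F w =
      -(ExteriorAlgebra.ι F w * ExteriorAlgebra.ι F v) :=
  eq_neg_of_add_eq_zero_left (ExteriorAlgebra.ι_add_mul_swap v w)

theorem commute_ι_mul_ι (v w : V) (y : ExteriorAlgebra F V) :
    Commute (ExteriorAlgebra.ι F v * ExteriorAlgebra.ι F w) y := by
  induction y using ExteriorAlgebra.induction with
  | algebraMap r => exact Algebra.commute_algebraMap_right r _
  | ι z =>
    rw [Commute, SemiconjBy, mul_assoc, ι_mul_ι_swap w z, mul_neg, ← mul_assoc, ι_mul_ι_swap v z,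
      neg_mul, neg_neg, mul_assoc]
  | mul a b ha hb => exact ha.mul_right hb
  | add a b ha hb => exact ha.add_right hb

theorem commute_prod_ι_of_even : ∀ l : List V, Even l.length → ∀ y : ExteriorAlgebra F V,
    Commute (l.map (ExteriorAlgebra.ι F)).prod y
  | [], _, y => by simp
  | [_], h, _ => by simp at h
  | v :: w :: l, h, y => by
    have h' : Even l.length := by
      rw [List.length_cons, List.length_cons, Nat.even_add_one, Nat.even_add_one, not_not] at h
      exact h
    rw [List.map_cons, List.map_cons, List.prod_cons, List.prod_cons, ← mul_assoc]
    exact (commute_ι_mul_ι v w y).mul_left (commute_prod_ι_of_even l h' y)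

/-- The product is central, so the two copies of its first factor can be brought together.
Nonemptiness excludes the empty product `1`. -/
theorem prod_ι_mul_self_of_even {l : List V} (h : Even l.length) (h0 : l ≠ []) :
    (l.map (ExteriorAlgebra.ι F)).prod * (l.map (ExteriorAlgebra.ι F)).prod = 0 := by
  have hc := commute_prod_ι_of_even (F := F) l h
  obtain ⟨v, l, rfl⟩ := List.exists_cons_of_ne_nil h0
  set u := (List.map (ExteriorAlgebra.ι F) (v :: l)).prod with hu
  rw [List.map_cons, List.prod_cons] at hu
  nth_rewrite 1 [hu]
  rw [mul_assoc, ← (hc _).eq, hu, mul_assoc, ← mul_assoc, ExteriorAlgebra.ι_sq_zero, zero_mul]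

theorem not_finiteDimensional_comap_ι {N : Submodule F (E F)}
    (h : ¬ FiniteDimensional F ↥(L F ⊓ N)) :
    ¬ FiniteDimensional F (N.comap (ExteriorAlgebra.ι F)) := by
  intro hfin
  apply h
  have : L F ⊓ N = (N.comap (ExteriorAlgebra.ι F)).map (ExteriorAlgebra.ι F) := by
    rw [Submodule.map_comap_eq, L]
  rw [this]
  infer_instance

theorem exists_prod_ι_mul_ne_zero {A : ℤ → Submodule F (E F)} [SetLike.GradedMonoid A] :
    ∀ (ds : List ℤ), (∀ d ∈ ds, ¬ FiniteDimensional F ↥(L F ⊓ A d)) → ∀ x : E F, x ≠ 0 →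
      ∃ l : List (ℕ →₀ F), l.length = ds.length ∧ (l.map (ExteriorAlgebra.ι F)).prod ∈ A ds.sum ∧
        (l.map (ExteriorAlgebra.ι F)).prod * x ≠ 0
  | [], _, x, hx => ⟨[], rfl, by simpa using SetLike.GradedOne.one_mem, by simpa using hx⟩
  | d :: ds, h, x, hx => by
    obtain ⟨l, h1, h2, h3⟩ := exists_prod_ι_mul_ne_zero ds
      (fun d hd => h d (List.mem_cons_of_mem _ hd)) x hx
    obtain ⟨v, hv, hne⟩ := exists_ι_mul_ne_zero
      (not_finiteDimensional_comap_ι (h d List.mem_cons_self)) h3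
    refine ⟨v :: l, by simp [h1], ?_, ?_⟩
    · rw [List.map_cons, List.prod_cons, List.sum_cons]
      exact SetLike.mul_mem_graded hv h2
    · rwa [List.map_cons, List.prod_cons, mul_assoc]

/-- If `h` is a combination of an even number of copies of `m` and `n`, then there are enough
central square-zero elements of degree `h`. -/
theorem exists_central_of_degrees {A : ℤ → Submodule F (E F)} [SetLike.GradedMonoid A] {m n : ℤ}
    (hm : ¬ FiniteDimensional F ↥(L F ⊓ A m)) (hn : ¬ FiniteDimensional F ↥(L F ⊓ A n))
    {h : ℤ} {p q : ℕ} (hpq : p * m + q * n = h) (heven : Even (p + q)) (hp : 0 < p)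
    (x : E F) (hx : x ≠ 0) : ∃ u ∈ A h, (∀ y, Commute u y) ∧ u * u = 0 ∧ u * x ≠ 0 := by
  obtain ⟨l, h1, h2, h3⟩ := exists_prod_ι_mul_ne_zero (A := A)
    (List.replicate p m ++ List.replicate q n) (fun d hd => by
      rcases List.mem_append.1 hd with hd | hd
      · rwa [List.eq_of_mem_replicate hd]
      · rwa [List.eq_of_mem_replicate hd]) x hx
  have hlen : l.length = p + q := by simpa using h1
  refine ⟨_, ?_, commute_prod_ι_of_even l (hlen ▸ heven),
    prod_ι_mul_self_of_even (hlen ▸ heven) ?_, h3⟩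
  · simpa [← hpq] using h2
  · rintro rfl
    simp at hlen
    omega

theorem exists_nat_combination {m n : ℤ} (hm : m < 0) (hn : 0 < n) (hmn : Int.gcd m n = 1) (h : ℤ)
    (hpar : Even h ∨ Even (m * n)) :
    ∃ p q : ℕ, p * m + q * n = h ∧ Even (p + q) ∧ 0 < p := by
  have hb : ∃ a b : ℤ, a * m + b * n = h := by
    refine ⟨h * Int.gcdA m n, h * Int.gcdB m n, ?_⟩
    have := Int.gcd_eq_gcd_ab m n
    rw [hmn] at this
    push_cast at this
    linear_combination (-h) * this
  obtain ⟨a, b, hab⟩ := hb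
  have key : ∀ a b : ℤ, a * m + b * n = h → Even (a + b) →
      ∃ p q : ℕ, p * m + q * n = h ∧ Even (p + q) ∧ 0 < p := by
    intro a b hab he
    -- Adding a multiple of `(n, -m)` preserves the combination. The factor `2` keeps the parity of
    -- `a + b`, and the size makes both coefficients nonnegative.
    have h1 : 0 < a + 2 * (|a| + |b| + 1) * n := by
      nlinarith [neg_abs_le a, abs_nonneg a, abs_nonneg b]
    have h2 : 0 ≤ b - 2 * (|a| + |b| + 1) * m := by
      nlinarith [neg_abs_le b, abs_nonneg a, abs_nonneg b]
    obtain ⟨p, hp⟩ := Int.eq_ofNat_of_zero_le h1.le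
    obtain ⟨q, hq⟩ := Int.eq_ofNat_of_zero_le h2
    refine ⟨p, q, ?_, ?_, by omega⟩
    · rw [← hp, ← hq]
      linear_combination hab
    · rw [← Int.even_coe_nat]
      push_cast
      rw [← hp, ← hq]
      have : a + 2 * (|a| + |b| + 1) * n + (b - 2 * (|a| + |b| + 1) * m) =
        (a + b) + 2 * ((|a| + |b| + 1) * (n - m)) := by ring
      rw [this]
      exact he.add (even_two_mul _)
  by_cases he : Even (a + b)
  · exact key a b hab he
  -- With exactly one of `m`, `n` even, a shift by `(n, -m)` flips the parity of `a + b`. With both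
  -- odd, `a + b` has the parity of `h`, which is even.
  by_cases hmo : Even m <;> by_cases hno : Even n
  · have h2 : (2 : ℤ) ∣ Int.gcd m n := Int.dvd_coe_gcd hmo.two_dvd hno.two_dvd
    rw [hmn] at h2
    norm_num at h2
  · refine key (a + n) (b - m) (by linear_combination hab) ?_
    simp only [Int.even_add, Int.even_sub] at he ⊢
    tauto
  · refine key (a + n) (b - m) (by linear_combination hab) ?_
    simp only [Int.even_add, Int.even_sub] at he ⊢
    tauto
  · exfalso
    have h1 : Even h := by
      rcases hpar with h1 | h1
      · exact h1
      · rw [Int.even_mul] at h1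
        tauto
    rw [← hab] at h1
    simp only [Int.even_add, Int.even_mul] at he h1
    tauto

/-- Contraction with the coordinate of the first letter strips it off, since that letter occurs
neither in the remaining word nor in `x`. -/
theorem prod_e_mul_ne_zero {x : E F} (hx : x ≠ 0) {s : Finset ℕ}
    (hs : ∀ φ : Module.Dual F (ℕ →₀ F), (∀ i ∈ s, φ (Finsupp.single i 1) = 0) →
      CliffordAlgebra.contractLeft φ x = 0) :
    ∀ l : List ℕ, l.Nodup → (∀ i ∈ l, i ∉ s) → (l.map (e F)).prod * x ≠ 0
  | [], _, _ => by simpa using hx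
  | i :: l, hl, hd => by
    have ih := prod_e_mul_ne_zero hx hs l hl.of_cons fun j hj => hd j (List.mem_cons_of_mem _ hj)
    have hi : i ∉ l := (List.nodup_cons.1 hl).1
    have hzero : ∀ l : List ℕ, i ∉ l → CliffordAlgebra.contractLeft (Finsupp.lapply i)
        ((l.map (e F)).prod * x) = 0 := by
      intro l
      induction l with
      | nil =>
        intro _
        have := hs (Finsupp.lapply i) fun j hj => by
          simpa using Finsupp.single_eq_of_ne (by
            rintro rfl; exact hd _ List.mem_cons_self hj)
        simpa using this
      | cons j l ih =>
        intro hij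
        rw [List.map_cons, List.prod_cons, mul_assoc]
        refine (CliffordAlgebra.contractLeft_ι_mul _ _ _).trans ?_
        rw [ih fun h => hij (List.mem_cons_of_mem _ h), mul_zero, sub_zero]
        have : (Finsupp.lapply i : (ℕ →₀ F) →ₗ[F] F) (Finsupp.single j 1) = 0 := by
          simpa using Finsupp.single_eq_of_ne (by rintro rfl; simp at hij)
        rw [this, zero_smul]
    intro h0
    rw [List.map_cons, List.prod_cons, mul_assoc] at h0
    have h := CliffordAlgebra.contractLeft_ι_mul (Q := (0 : QuadraticForm F (ℕ →₀ F)))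
      (Finsupp.lapply i) (Finsupp.single i 1) ((l.map (e F)).prod * x)
    change CliffordAlgebra.contractLeft _ (e F i * _) = _ at h
    rw [h0, map_zero, hzero l hi, mul_zero, sub_zero] at h
    exact ih (by simpa using h.symm)

theorem exists_central_of_monomials {T : Set (Finset ℕ)} (hT : T.Infinite)
    (hd : T.PairwiseDisjoint id) (he : ∀ t ∈ T, Even t.card) (x : E F) (hx : x ≠ 0) :
    ∃ t ∈ T, (∀ y, Commute (basisMonomial F t) y) ∧
      basisMonomial F t * basisMonomial F t = 0 ∧ basisMonomial F t * x ≠ 0 := by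
  obtain ⟨s, hs⟩ := exists_finset_contractLeft_eq_zero x
  have : ∃ t ∈ T, t ≠ ∅ ∧ Disjoint t s := by
    by_contra h
    push Not at h
    apply hT
    -- By disjointness each `i ∈ s` lies in at most one member of `T`, so `T` would be finite.
    have hsub : T \ {∅} ⊆ ⋃ i ∈ s, {t ∈ T | i ∈ t} := by
      rintro t ⟨ht, ht0⟩
      obtain ⟨i, hit, his⟩ := Finset.not_disjoint_iff.1 (h t ht (Finset.nonempty_iff_ne_empty.2 ht0))
      simp only [Set.mem_iUnion]
      exact ⟨i, his, ht, hit⟩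
    have hfin : (⋃ i ∈ s, {t ∈ T | i ∈ t}).Finite := by
      refine s.finite_toSet.biUnion fun i _ => Set.Subsingleton.finite ?_
      rintro t ⟨ht, hit⟩ t' ⟨ht', hit'⟩
      by_contra hne
      exact Finset.disjoint_left.1 (hd ht ht' hne) hit hit'
    exact ((hfin.subset hsub).union (Set.finite_singleton ∅)).subset fun t ht => by
      by_cases h0 : t = ∅
      · exact Or.inr h0
      · exact Or.inl ⟨ht, h0⟩
  obtain ⟨t, ht, ht0, hts⟩ := this
  have hm : basisMonomial F t = (((t.sort (· ≤ ·)).map fun i => Finsupp.single i (1 : F)).map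
      (ExteriorAlgebra.ι F)).prod := by
    rw [List.map_map]
    rfl
  have hl : Even ((t.sort (· ≤ ·)).map fun i => Finsupp.single i (1 : F)).length := by
    simpa using he t ht
  refine ⟨t, ht, ?_, ?_, ?_⟩
  · rw [hm]
    exact commute_prod_ι_of_even _ hl
  · rw [hm]
    refine prod_ι_mul_self_of_even hl fun h => ht0 ?_
    have := congrArg List.length h
    simpa using this
  · refine prod_e_mul_ne_zero hx hs _ (Finset.sort_nodup _ _) fun i hi => ?_
    exact Finset.disjoint_left.1 hts ((Finset.mem_sort _).1 hi)

theorem gradedIdentities_le_comap_inducedMod2 [CharZero F] (A : ℤ → Submodule F (E F))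
    [SetLike.GradedMonoid A] {S : Set ℕ}
    (hS : IsCentral S (restrictGrading (subGrassmann F S) A)) :
    gradedIdentities A ≤ TwoSidedIdeal.comap (reduceMod2 F)
      (gradedIdentities (inducedMod2 (restrictGrading (subGrassmann F S) A))) := by
  intro f hf
  rw [TwoSidedIdeal.mem_comap, mem_gradedIdentities]
  intro a ha
  apply Subtype.val_injective
  have hcomp : FreeAlgebra.lift F (fun q : ℤ × ℕ => (a ((q.1 : ZMod 2), q.2) : E F)) =
      (subGrassmann F S).val.comp ((FreeAlgebra.lift F a).comp (reduceMod2 F)) := by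
    ext q
    simp [reduceMod2, X]
  have := DFunLike.congr_fun hcomp f
  refine this.symm.trans ?_
  refine lift_eq_zero_of_mem_gradedIdentities (H := {h | Even h}) (A := A) ?_ hf _ ?_
  · intro h hh x hx
    obtain ⟨T, hT, hd, hTm⟩ := hS.central h hh
    obtain ⟨t, ht, h1, h2, h3⟩ :=
      exists_central_of_monomials hT hd (fun t ht => (hTm t ht).2.1) x hx
    obtain ⟨b, hb, hbt⟩ := (hTm t ht).2.2
    refine ⟨_, ?_, h1, h2, h3⟩
    rw [← hbt]
    exact hb
  · rintro ⟨n, i⟩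
    have hle : inducedMod2 (restrictGrading (subGrassmann F S) A) (n : ZMod 2) ≤
        (⨆ r : {r : ℤ // n - r ∈ {h | Even h}}, A r.1).comap
          (subGrassmann F S).val.toLinearMap := by
      refine iSup_le fun r x hx => ?_
      refine Submodule.mem_iSup_of_mem (p := fun r : {r : ℤ // n - r ∈ {h | Even h}} => A r.1)
        ⟨r.1, ?_⟩ hx
      change Even (n - r.1)
      rw [← ZMod.intCast_eq_zero_iff_even, Int.cast_sub, r.2, sub_self]
    exact hle (ha (n : ZMod 2) i)

end Supply

/-! ### Normal forms in supercommutative algebras. -/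

section NormalForms

variable {F : Type*} [Field F] {R : Type*} [Ring R] [Algebra F R]

theorem lift_mem_of_left_mul_mem {ι : Type*} (w : ι → R) (N : Submodule F R) (h1 : 1 ∈ N)
    (h : ∀ i, ∀ n ∈ N, w i * n ∈ N) (f : FreeAlgebra F ι) : FreeAlgebra.lift F w f ∈ N := by
  suffices H : ∀ n ∈ N, FreeAlgebra.lift F w f * n ∈ N by simpa using H 1 h1
  induction f using FreeAlgebra.induction with
  | grade0 r =>
    intro n hn
    rw [AlgHom.commutes, ← Algebra.smul_def]
    exact N.smul_mem r hn
  | grade1 i => simpa using h i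
  | mul a b ha hb =>
    intro n hn
    rw [map_mul, mul_assoc]
    exact ha _ (hb n hn)
  | add a b ha hb =>
    intro n hn
    rw [map_add, add_mul]
    exact add_mem (ha n hn) (hb n hn)

/-- A polynomial with vector coefficients which vanishes at all points has zero coefficients. -/
theorem coeff_eq_zero_of_forall_sum_smul_eq_zero [CharZero F] {κ V : Type*} [AddCommGroup V]
    [Module F V] (s : Finset (κ →₀ ℕ)) (ω : (κ →₀ ℕ) → V)
    (h : ∀ c : κ → F, ∑ α ∈ s, (α.prod fun i k => c i ^ k) • ω α = 0) : ∀ α ∈ s, ω α = 0 := by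
  classical
  intro α hα
  rw [← Module.forall_dual_apply_eq_zero_iff F]
  intro φ
  have hp : ∑ β ∈ s, MvPolynomial.monomial β (φ (ω β)) = (0 : MvPolynomial κ F) := by
    refine MvPolynomial.funext fun c => ?_
    rw [map_sum, map_zero]
    simp only [MvPolynomial.eval_monomial]
    have := congrArg φ (h c)
    rw [map_sum, map_zero] at this
    rw [← this]
    refine Finset.sum_congr rfl fun β _ => ?_
    rw [map_smul, smul_eq_mul, mul_comm]
  have := congrArg (MvPolynomial.coeff α) hp
  rw [MvPolynomial.coeff_sum] at this
  simpa [MvPolynomial.coeff_monomial, hα] using this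

section Supercommutative

variable {ι : Type*} {ev : ι → Prop}

theorem linearCombination_mul_self (y : ι → R) (hy : ∀ i j, y i * y j + y j * y i = 0)
    [CharZero F] (v : ι →₀ F) :
    Finsupp.linearCombination F y v * Finsupp.linearCombination F y v = 0 := by
  have key : ∀ v w : ι →₀ F, Finsupp.linearCombination F y v * Finsupp.linearCombination F y w +
      Finsupp.linearCombination F y w * Finsupp.linearCombination F y v = 0 := by
    intro v w
    induction v using Finsupp.induction_linear with
    | zero => simp
    | add a b ha hb =>
      rw [map_add, add_mul, mul_add, add_add_add_comm, ha, hb, add_zero]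
    | single i a =>
      induction w using Finsupp.induction_linear with
      | zero => simp
      | add a b ha hb =>
        rw [map_add, add_mul, mul_add, add_add_add_comm, ha, hb, add_zero]
      | single j b =>
        rw [Finsupp.linearCombination_single, Finsupp.linearCombination_single, smul_mul_smul_comm,
          smul_mul_smul_comm, mul_comm b a, ← smul_add, hy, smul_zero]
  have h := key v v
  rw [← two_smul F] at h
  exact (smul_eq_zero.1 h).resolve_left two_ne_zero

/-- The free supercommutative algebra is separated by its specialisations of the even variables
at scalars and of the odd variables at the generators of an exterior algebra. -/
theorem lift_eq_zero_of_supercommutative_of_specialization [CharZero F] (w : ι → R)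
    (hev : ∀ i, ev i → ∀ r, Commute (w i) r)
    (hodd : ∀ i j, ¬ ev i → ¬ ev j → w i * w j + w j * w i = 0) (f : FreeAlgebra F ι)
    (hρ : ∀ c : {i // ev i} → F, ∃ ρ : R →ₐ[F] ExteriorAlgebra F ({i // ¬ ev i} →₀ F),
      (∀ i : {i // ev i}, ρ (w i) = algebraMap F _ (c i)) ∧
      (∀ i : {i // ¬ ev i}, ρ (w i) = ExteriorAlgebra.ι F (Finsupp.single i 1)) ∧
      ρ (FreeAlgebra.lift F w f) = 0) :
    FreeAlgebra.lift F w f = 0 := by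
  classical
  let y : {i // ¬ ev i} → R := fun i => w i
  let z : {i // ev i} → Subalgebra.center F R := fun i =>
    ⟨w i, Subalgebra.mem_center_iff.2 fun r => ((hev i i.2 r).eq).symm⟩
  let c : ExteriorAlgebra F ({i // ¬ ev i} →₀ F) →ₐ[F] R :=
    ExteriorAlgebra.lift F ⟨Finsupp.linearCombination F y,
      linearCombination_mul_self y fun i j => hodd i j i.2 j.2⟩
  have hc : ∀ i, c (ExteriorAlgebra.ι F (Finsupp.single i 1)) = w i := by
    intro i
    simp [c, y]
  let m : ({i // ev i} →₀ ℕ) → R := fun α =>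
    ((α.prod fun i k => z i ^ k : Subalgebra.center F R) : R)
  have hmc : ∀ α r, Commute (m α) r := fun α r =>
    (Subalgebra.mem_center_iff.1 (α.prod fun i k => z i ^ k : Subalgebra.center F R).2 r).symm
  have hm1 : ∀ (i : {i // ev i}) α, m (Finsupp.single i 1 + α) = w i * m α := by
    intro i α
    simp only [m]
    rw [Finsupp.prod_add_index' (fun _ => pow_zero _) (fun _ _ _ => pow_add _ _ _),
      Finsupp.prod_single_index (h := fun i k => z i ^ k) (pow_zero _), pow_one]
    rfl
  -- Normal form: a polynomial in the even generators with coefficients in the exterior algebra on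
  -- the odd ones.
  let Ψ : (({i // ev i} →₀ ℕ) →₀ ExteriorAlgebra F ({i // ¬ ev i} →₀ F)) →ₗ[F] R :=
    Finsupp.lsum F fun α => (LinearMap.mulLeft F (m α)).comp c.toLinearMap
  have hΨ : ∀ α ω, Ψ (Finsupp.single α ω) = m α * c ω := by
    intro α ω
    simp [Ψ]
  have hmem : FreeAlgebra.lift F w f ∈ LinearMap.range Ψ := by
    refine lift_mem_of_left_mul_mem w (LinearMap.range Ψ) ?_ ?_ f
    · refine ⟨Finsupp.single 0 1, ?_⟩
      rw [hΨ]
      simp [m]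
    · rintro i _ ⟨n, rfl⟩
      induction n using Finsupp.induction_linear with
      | zero => simp
      | add a b ha hb =>
        rw [map_add, mul_add]
        exact add_mem ha hb
      | single α ω =>
        by_cases hi : ev i
        · exact ⟨Finsupp.single (Finsupp.single ⟨i, hi⟩ 1 + α) ω, by
            rw [hΨ, hΨ, hm1, mul_assoc]⟩
        · refine ⟨Finsupp.single α (ExteriorAlgebra.ι F (Finsupp.single ⟨i, hi⟩ 1) * ω), ?_⟩
          rw [hΨ, hΨ, map_mul, hc, ← mul_assoc, ← mul_assoc, (hmc α _).eq]
  obtain ⟨n, hn⟩ := hmem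
  suffices hn0 : n = 0 by rw [← hn, hn0, map_zero]
  -- Applying `ρ` evaluates this polynomial at the scalars `b`; vanishing for every `b` kills all
  -- coefficients.
  have hzero := coeff_eq_zero_of_forall_sum_smul_eq_zero (F := F) n.support n fun b => by
    obtain ⟨ρ, h1, h2, h3⟩ := hρ b
    have hρc : ρ.comp c = AlgHom.id F _ := by
      ext i
      simp [hc, h2]
    have hρc' : ∀ ω, ρ (c ω) = ω := fun ω => DFunLike.congr_fun hρc ω
    have hρm : ∀ α, ρ (m α) = algebraMap F _ (α.prod fun i k => b i ^ k) := by
      intro α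
      induction α using Finsupp.induction_linear with
      | zero => simp [m]
      | add α β hα hβ =>
        have : m (α + β) = m α * m β := by
          simp only [m]
          rw [Finsupp.prod_add_index' (fun _ => pow_zero _) (fun _ _ _ => pow_add _ _ _)]
          rfl
        rw [this, map_mul, hα, hβ, ← map_mul,
          Finsupp.prod_add_index' (fun _ => pow_zero _) (fun _ _ _ => pow_add _ _ _)]
      | single i k =>
        have : m (Finsupp.single i k) = w i ^ k := by
          simp only [m]
          rw [Finsupp.prod_single_index (h := fun i k => z i ^ k) (pow_zero _)]
          rfl
        rw [this, map_pow, h1, Finsupp.prod_single_index (h := fun i k => b i ^ k) (pow_zero _),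
          map_pow]
    rw [← hn] at h3
    rw [← h3]
    simp only [Ψ, Finsupp.lsum_apply, Finsupp.sum, map_sum]
    refine Finset.sum_congr rfl fun α _ => ?_
    simp [hρm, hρc', Algebra.smul_def]
  ext α : 1
  by_cases hα : α ∈ n.support
  · exact hzero α hα
  · simpa using hα

theorem lift_eq_zero_of_supercommutative [CharZero F] (w : ι → R)
    (hev : ∀ i, ev i → ∀ r, Commute (w i) r)
    (hodd : ∀ i j, ¬ ev i → ¬ ev j → w i * w j + w j * w i = 0) (f : FreeAlgebra F ι)
    (t : ({i // ev i} → F) → ι → ExteriorAlgebra F ({i // ¬ ev i} →₀ F))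
    (ht1 : ∀ c (i : {i // ev i}), t c i = algebraMap F _ (c i))
    (ht2 : ∀ c (i : {i // ¬ ev i}), t c i = ExteriorAlgebra.ι F (Finsupp.single i 1))
    (hf : ∀ c, FreeAlgebra.lift F (t c) f = 0) :
    FreeAlgebra.lift F w f = 0 := by
  let w' : ι → R × (({i // ev i} → F) → ExteriorAlgebra F ({i // ¬ ev i} →₀ F)) :=
    fun i => (w i, fun c => t c i)
  have hfst : FreeAlgebra.lift F w = (AlgHom.fst F R _).comp (FreeAlgebra.lift F w') := by
    ext i
    simp [w']
  have hsnd : ∀ c, FreeAlgebra.lift F (t c) = ((Pi.evalAlgHom F _ c).comp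
      (AlgHom.snd F R _)).comp (FreeAlgebra.lift F w') := by
    intro c
    ext i
    simp [w']
  have h0 : FreeAlgebra.lift F w' f = 0 := by
    refine lift_eq_zero_of_supercommutative_of_specialization (ev := ev) w' ?_ ?_ f fun c =>
      ⟨(Pi.evalAlgHom F _ c).comp (AlgHom.snd F R _), fun i => ht1 c i, fun i => ht2 c i, ?_⟩
    · intro i hi r
      refine Prod.ext (hev i hi r.1).eq (funext fun c => ?_)
      have := ht1 c ⟨i, hi⟩
      simp only at this
      simp only [w', Prod.snd_mul, Pi.mul_apply, this]
      exact Algebra.commutes _ _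
    · intro i j hi hj
      refine Prod.ext (hodd i j hi hj) (funext fun c => ?_)
      have h1 := ht2 c ⟨i, hi⟩
      have h2 := ht2 c ⟨j, hj⟩
      simp only at h1 h2
      simp only [w', Prod.snd_add, Prod.snd_mul, Pi.add_apply, Pi.mul_apply, h1, h2]
      exact ExteriorAlgebra.ι_add_mul_swap _ _
    · rw [← hf c, hsnd c]
      rfl
  rw [hfst, AlgHom.comp_apply, h0, map_zero]

end Supercommutative

end NormalForms

/-! ### Identities of algebras that are Lie nilpotent of class two. -/

section LieNilpotent

variable {F : Type*} [Field F] {R : Type*} [Ring R] [Algebra F R] {ι : Type*}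

/-- Expand `[[a * b, c], b] = 0`. This is the relation needed for half commutators to define a map
from the even exterior algebra. -/
theorem lie_mul_lie_eq_zero (hR : ∀ a b c : R, ⁅⁅a, b⁆, c⁆ = 0) (a b c : R) :
    ⁅a, b⁆ * ⁅b, c⁆ = 0 := by
  have h1 : ⁅a * b, c⁆ = a * ⁅b, c⁆ + ⁅a, c⁆ * b := by
    simp only [Ring.lie_def]
    noncomm_ring
  have h2 : ⁅⁅a * b, c⁆, b⁆ = ⁅a, b⁆ * ⁅b, c⁆ + a * ⁅⁅b, c⁆, b⁆ + ⁅⁅a, c⁆, b⁆ * b := by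
    rw [h1]
    simp only [Ring.lie_def]
    noncomm_ring
  rw [hR, hR, hR, mul_zero, zero_mul, add_zero, add_zero] at h2
  exact h2.symm

theorem commute_of_mem_even {V : Type*} [AddCommGroup V] [Module F V] {x : ExteriorAlgebra F V}
    (hx : x ∈ CliffordAlgebra.evenOdd (0 : QuadraticForm F V) 0) (y : ExteriorAlgebra F V) :
    Commute x y := by
  induction x, hx using CliffordAlgebra.even_induction with
  | algebraMap r => exact Algebra.commute_algebraMap_left r y
  | add x z _ _ hx hz => exact hx.add_left hz
  | ι_mul_ι_mul v w x _ hx => exact (commute_ι_mul_ι v w y).mul_left hx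

theorem exterior_lie_lie {V : Type*} [AddCommGroup V] [Module F V]
    (a b c : ExteriorAlgebra F V) : ⁅⁅a, b⁆, c⁆ = 0 := by
  have hdec : ∀ x : ExteriorAlgebra F V,
      ∃ x₀ ∈ CliffordAlgebra.evenOdd (0 : QuadraticForm F V) 0,
        ∃ x₁ ∈ CliffordAlgebra.evenOdd (0 : QuadraticForm F V) 1, x₀ + x₁ = x := by
    intro x
    rw [← Submodule.mem_sup, (CliffordAlgebra.evenOdd_isCompl _).sup_eq_top]
    trivial
  obtain ⟨a₀, ha₀, a₁, ha₁, rfl⟩ := hdec a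
  obtain ⟨b₀, hb₀, b₁, hb₁, rfl⟩ := hdec b
  have hmul : ∀ x ∈ CliffordAlgebra.evenOdd (0 : QuadraticForm F V) 1,
      ∀ y ∈ CliffordAlgebra.evenOdd (0 : QuadraticForm F V) 1,
        x * y ∈ CliffordAlgebra.evenOdd (0 : QuadraticForm F V) 0 := fun x hx y hy =>
    CliffordAlgebra.evenOdd_mul_le _ 1 1 (Submodule.mul_mem_mul hx hy)
  -- Even parts are central, so only odd parts contribute, and their commutator is again even.
  have hlie : ⁅a₀ + a₁, b₀ + b₁⁆ = a₁ * b₁ - b₁ * a₁ := by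
    have h : (a₀ + a₁) * (b₀ + b₁) - (b₀ + b₁) * (a₀ + a₁) = (a₁ * b₁ - b₁ * a₁) +
        ((a₀ + a₁) * b₀ - b₀ * (a₀ + a₁)) + (a₀ * b₁ - b₁ * a₀) := by noncomm_ring
    rw [Ring.lie_def, h, (commute_of_mem_even ha₀ b₁).eq, (commute_of_mem_even hb₀ _).eq,
      sub_self, sub_self, add_zero, add_zero]
  rw [hlie, ← commute_iff_lie_eq]
  exact commute_of_mem_even (sub_mem (hmul _ ha₁ _ hb₁) (hmul _ hb₁ _ ha₁)) c

/-- The even homomorphism `(v, w) ↦ ½ [v, w]` into an algebra which is Lie nilpotent of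
class two. -/
noncomputable def halfCommutator [CharZero F] (hR : ∀ a b c : R, ⁅⁅a, b⁆, c⁆ = 0) (x : ι → R) :
    CliffordAlgebra.EvenHom (0 : QuadraticForm F (ι →₀ F)) (Subalgebra.center F R) where
  bilin := LinearMap.mk₂ F
    (fun v w => ⟨(2⁻¹ : F) • ⁅Finsupp.linearCombination F x v, Finsupp.linearCombination F x w⁆,
      Subalgebra.smul_mem _ (Subalgebra.mem_center_iff.2 fun r =>
        (commute_iff_lie_eq.2 (hR _ _ r)).eq.symm) _⟩)
    (fun _ _ _ => Subtype.ext <| by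
      simp only [Ring.lie_def, map_add, add_mul, mul_add, AddMemClass.mk_add_mk, ← smul_add]
      congr 1
      abel)
    (fun a _ _ => Subtype.ext <| by
      simp [Ring.lie_def, ← smul_sub, smul_comm a (2⁻¹ : F)])
    (fun _ _ _ => Subtype.ext <| by
      simp only [Ring.lie_def, map_add, add_mul, mul_add, AddMemClass.mk_add_mk, ← smul_add]
      congr 1
      abel)
    (fun a _ _ => Subtype.ext <| by
      simp [Ring.lie_def, ← smul_sub, smul_comm a (2⁻¹ : F)])
  contract v := Subtype.ext <| by simp [Ring.lie_def]
  contract_mid u v w := Subtype.ext <| by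
    simp [lie_mul_lie_eq_zero hR]

/-- The homomorphism from the even part of the exterior algebra which sends `v ∧ w`
to `½ [v, w]`. -/
noncomputable def evenPartHom [CharZero F] (hR : ∀ a b c : R, ⁅⁅a, b⁆, c⁆ = 0) (x : ι → R) :
    CliffordAlgebra.even (0 : QuadraticForm F (ι →₀ F)) →ₐ[F] R :=
  (Subalgebra.center F R).val.comp (CliffordAlgebra.even.lift _ (halfCommutator hR x))

/-- Isolates the leading term in `s` of a specialised word. The functional `φ` varies in the
induction so that it can absorb left multiplication by a generator. -/
theorem apply_word (c : ι → F) (l : List ι) (ω : ExteriorAlgebra F (ι →₀ F)) :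
    ∀ φ : Module.Dual F (ExteriorAlgebra F (ι →₀ F)), ∃ p : Polynomial F,
      (∀ k, l.length ≤ k → p.coeff k = 0) ∧ ∀ s : F,
        φ ((l.map fun i => algebraMap F _ (s * c i) +
          ExteriorAlgebra.ι F (Finsupp.single i 1)).prod * ω) =
            s ^ l.length * ((l.map c).prod * φ ω) + p.eval s := by
  induction l with
  | nil => exact fun φ => ⟨0, by simp⟩
  | cons i l ih =>
    intro φ
    obtain ⟨p, hp, hps⟩ := ih φ
    obtain ⟨q, hq, hqs⟩ := ih
      (φ.comp (LinearMap.mulLeft F (ExteriorAlgebra.ι F (Finsupp.single i 1))))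
    refine ⟨Polynomial.C (c i) * (Polynomial.X * p) + (Polynomial.C ((l.map c).prod *
      φ (ExteriorAlgebra.ι F (Finsupp.single i 1) * ω)) * Polynomial.X ^ l.length + q),
      fun k hk => ?_, fun s => ?_⟩
    · obtain ⟨k, rfl⟩ := Nat.exists_eq_succ_of_ne_zero
        (Nat.ne_zero_of_lt (lt_of_lt_of_le (Nat.succ_pos _) hk))
      have hk' : l.length ≤ k := by simpa using hk
      have hk2 : k + 1 ≠ l.length := by omega
      rw [Polynomial.coeff_add, Polynomial.coeff_add, Polynomial.coeff_C_mul,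
        Polynomial.coeff_X_mul, Polynomial.coeff_C_mul, Polynomial.coeff_X_pow, if_neg hk2,
        hp k hk', hq (k + 1) (by omega)]
      simp
    · have h1 := hps s
      have h2 := hqs s
      simp only [LinearMap.comp_apply, LinearMap.mulLeft_apply] at h2
      rw [List.map_cons, List.prod_cons, mul_assoc, add_mul, map_add, h2, ← Algebra.smul_def,
        map_smul, h1]
      simp
      ring

section Filtration

variable [CharZero F] (hR : ∀ a b c : R, ⁅⁅a, b⁆, c⁆ = 0) (x : ι → R)

theorem commute_evenPartHom (ω : CliffordAlgebra.even (0 : QuadraticForm F (ι →₀ F))) (r : R) :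
    Commute (evenPartHom hR x ω) r :=
  (Subalgebra.mem_center_iff.1
    (CliffordAlgebra.even.lift _ (halfCommutator (F := F) hR x) ω).2 r).symm

theorem lie_mem_range_evenPartHom (i j : ι) :
    ∃ ω : CliffordAlgebra.even (0 : QuadraticForm F (ι →₀ F)),
      evenPartHom hR x ω = ⁅x i, x j⁆ := by
  refine ⟨(2 : F) • (CliffordAlgebra.even.ι _).bilin (Finsupp.single i 1) (Finsupp.single j 1), ?_⟩
  rw [map_smul, evenPartHom, AlgHom.comp_apply, CliffordAlgebra.even.lift_ι]
  simp [halfCommutator]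

/-- Scalars drop out of commutators, so every such `ρ` inverts `evenPartHom`, independently of `c`.
-/
theorem apply_evenPartHom (c : ι → F) (ρ : R →ₐ[F] ExteriorAlgebra F (ι →₀ F))
    (hρ : ∀ i, ρ (x i) = algebraMap F _ (c i) + ExteriorAlgebra.ι F (Finsupp.single i 1))
    (ω : CliffordAlgebra.even (0 : QuadraticForm F (ι →₀ F))) :
    ρ (evenPartHom hR x ω) = (ω : ExteriorAlgebra F (ι →₀ F)) := by
  have hlin : ∀ v, ∃ z : F, ρ (Finsupp.linearCombination F x v) =
      algebraMap F _ z + ExteriorAlgebra.ι F v := by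
    intro v
    induction v using Finsupp.induction_linear with
    | zero => exact ⟨0, by simp⟩
    | add a b ha hb =>
      obtain ⟨z, hz⟩ := ha
      obtain ⟨z', hz'⟩ := hb
      exact ⟨z + z', by rw [map_add, map_add, hz, hz', map_add, map_add]; abel⟩
    | single i a =>
      refine ⟨a * c i, ?_⟩
      rw [Finsupp.linearCombination_single, map_smul, hρ, smul_add, map_mul, ← Algebra.smul_def,
        ← map_smul (ExteriorAlgebra.ι F), Finsupp.smul_single, smul_eq_mul, mul_one]
  suffices h : ρ.comp (evenPartHom hR x) =
      (CliffordAlgebra.even (0 : QuadraticForm F (ι →₀ F))).val from DFunLike.congr_fun h ω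
  refine CliffordAlgebra.even.algHom_ext _ (CliffordAlgebra.EvenHom.ext
    (LinearMap.ext₂ fun v w => ?_))
  change ρ ((CliffordAlgebra.even.lift _ (halfCommutator hR x)
    ((CliffordAlgebra.even.ι _).bilin v w) : Subalgebra.center F R) : R) =
      ExteriorAlgebra.ι F v * ExteriorAlgebra.ι F w
  rw [CliffordAlgebra.even.lift_ι]
  change ρ ((2⁻¹ : F) • ⁅Finsupp.linearCombination F x v, Finsupp.linearCombination F x w⁆) = _
  obtain ⟨z, hz⟩ := hlin v
  obtain ⟨z', hz'⟩ := hlin w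
  rw [map_smul, Ring.lie_def, map_sub, map_mul, map_mul, hz, hz']
  have : (algebraMap F (ExteriorAlgebra F (ι →₀ F)) z + ExteriorAlgebra.ι F v) *
      (algebraMap F _ z' + ExteriorAlgebra.ι F w) -
      (algebraMap F _ z' + ExteriorAlgebra.ι F w) * (algebraMap F _ z + ExteriorAlgebra.ι F v) =
      (2 : F) • (ExteriorAlgebra.ι F v * ExteriorAlgebra.ι F w) := by
    simp only [add_mul, mul_add]
    rw [Algebra.commutes z (ExteriorAlgebra.ι F w), Algebra.commutes z' (ExteriorAlgebra.ι F v),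
      Algebra.commutes z' (algebraMap F _ z), ι_mul_ι_swap w v, two_smul]
    abel
  rw [this, smul_smul, inv_mul_cancel₀ two_ne_zero, one_smul]

/-- The span of the words of length less than `d` in the generators, with coefficients in the
algebra generated by the commutators. -/
noncomputable def wordSpan (d : ℕ) : Submodule F R :=
  Submodule.span F {y | ∃ l : List ι, l.length < d ∧
    ∃ ω : CliffordAlgebra.even (0 : QuadraticForm F (ι →₀ F)),
      y = (l.map x).prod * evenPartHom hR x ω}

variable {hR x}

theorem word_mul_mem_wordSpan {l : List ι} {d : ℕ} (h : l.length < d)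
    (ω : CliffordAlgebra.even (0 : QuadraticForm F (ι →₀ F))) :
    (l.map x).prod * evenPartHom hR x ω ∈ wordSpan (F := F) hR x d :=
  Submodule.subset_span ⟨l, h, ω, rfl⟩

theorem wordSpan_mono {d d' : ℕ} (h : d ≤ d') :
    wordSpan (F := F) hR x d ≤ wordSpan hR x d' :=
  Submodule.span_mono fun _ ⟨l, hl, hy⟩ => ⟨l, hl.trans_le h, hy⟩

theorem mul_mem_wordSpan_succ (i : ι) {d : ℕ} {y : R} (hy : y ∈ wordSpan (F := F) hR x d) :
    x i * y ∈ wordSpan (F := F) hR x (d + 1) := by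
  have : wordSpan (F := F) hR x d ≤
      (wordSpan (F := F) hR x (d + 1)).comap (LinearMap.mulLeft F (x i)) := by
    refine Submodule.span_le.2 ?_
    rintro _ ⟨l, hl, ω, rfl⟩
    have := word_mul_mem_wordSpan (hR := hR) (x := x) (l := i :: l) (d := d + 1) (by simpa) ω
    rw [List.map_cons, List.prod_cons, mul_assoc] at this
    exact this
  exact this hy

theorem mul_evenPartHom_mem_wordSpan {d : ℕ} {y : R} (hy : y ∈ wordSpan (F := F) hR x d)
    (ω : CliffordAlgebra.even (0 : QuadraticForm F (ι →₀ F))) :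
    y * evenPartHom hR x ω ∈ wordSpan (F := F) hR x d := by
  have : wordSpan (F := F) hR x d ≤
      (wordSpan (F := F) hR x d).comap (LinearMap.mulRight F (evenPartHom hR x ω)) := by
    refine Submodule.span_le.2 ?_
    rintro _ ⟨l, hl, ω', rfl⟩
    have := word_mul_mem_wordSpan (hR := hR) (x := x) hl (ω' * ω)
    rw [map_mul, ← mul_assoc] at this
    exact this
  exact this hy

theorem exists_lift_mem_wordSpan (f : FreeAlgebra F ι) :
    ∃ d, FreeAlgebra.lift F x f ∈ wordSpan (F := F) hR x d := by
  have hdir : Directed (· ≤ ·) fun d => wordSpan (F := F) hR x d :=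
    Monotone.directed_le fun _ _ h => wordSpan_mono h
  rw [← Submodule.mem_iSup_of_directed _ hdir]
  refine lift_mem_of_left_mul_mem x _ ?_ ?_ f
  · rw [Submodule.mem_iSup_of_directed _ hdir]
    exact ⟨1, by simpa using word_mul_mem_wordSpan (hR := hR) (x := x) (l := []) one_pos 1⟩
  · intro i n hn
    rw [Submodule.mem_iSup_of_directed _ hdir] at hn ⊢
    obtain ⟨d, hd⟩ := hn
    exact ⟨d + 1, mul_mem_wordSpan_succ i hd⟩

variable (hR) in
-- Swapping adjacent letters costs a central commutator times a word with two fewer letters; hence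
-- leading terms depend only on multisets.
theorem prod_sub_prod_mem_wordSpan {l l' : List ι} (h : l.Perm l') :
    (l.map x).prod - (l'.map x).prod ∈ wordSpan (F := F) hR x l.length := by
  induction h with
  | nil => simp
  | cons i _ ih =>
    rw [List.map_cons, List.map_cons, List.prod_cons, List.prod_cons, ← mul_sub]
    exact mul_mem_wordSpan_succ i ih
  | swap i j l =>
    obtain ⟨ω, hω⟩ := lie_mem_range_evenPartHom (F := F) hR x j i
    have := word_mul_mem_wordSpan (hR := hR) (x := x) (l := l) (d := (j :: i :: l).length)
      (by simp) ω
    rw [← (commute_evenPartHom hR x ω _).eq, hω, Ring.lie_def, sub_mul, mul_assoc,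
      mul_assoc] at this
    simpa using this
  | trans h1 _ ih1 ih2 =>
    rw [← h1.length_eq] at ih2
    simpa using add_mem ih1 ih2

theorem exists_polynomial_of_mem_wordSpan (c : ι → F)
    (ρ : F → R →ₐ[F] ExteriorAlgebra F (ι →₀ F))
    (hρ : ∀ s i, ρ s (x i) =
      algebraMap F _ (s * c i) + ExteriorAlgebra.ι F (Finsupp.single i 1))
    (φ : Module.Dual F (ExteriorAlgebra F (ι →₀ F))) {d : ℕ} {y : R}
    (hy : y ∈ wordSpan (F := F) hR x d) :
    ∃ p : Polynomial F, (∀ k, d ≤ k → p.coeff k = 0) ∧ ∀ s, φ (ρ s y) = p.eval s := by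
  induction hy using Submodule.span_induction with
  | zero => exact ⟨0, by simp⟩
  | add a b _ _ ha hb =>
    obtain ⟨p, hp, hps⟩ := ha
    obtain ⟨q, hq, hqs⟩ := hb
    exact ⟨p + q, fun k hk => by simp [hp k hk, hq k hk], fun s => by simp [hps, hqs]⟩
  | smul a b _ hb =>
    obtain ⟨q, hq, hqs⟩ := hb
    exact ⟨a • q, fun k hk => by simp [hq k hk], fun s => by simp [hqs]⟩
  | mem y hy =>
    obtain ⟨l, hl, ω, rfl⟩ := hy
    obtain ⟨p, hp, hps⟩ := apply_word c l (ω : ExteriorAlgebra F (ι →₀ F)) φ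
    refine ⟨Polynomial.C ((l.map c).prod * φ ω) * Polynomial.X ^ l.length + p,
      fun k hk => ?_, fun s => ?_⟩
    · have : k ≠ l.length := by omega
      rw [Polynomial.coeff_add, Polynomial.coeff_C_mul, Polynomial.coeff_X_pow, if_neg this,
        hp k (by omega), mul_zero, add_zero]
    · rw [map_mul, apply_evenPartHom hR x _ (ρ s) (hρ s), map_list_prod, List.map_map]
      have : (ρ s : R → _) ∘ x = fun i => algebraMap F _ (s * c i) +
          ExteriorAlgebra.ι F (Finsupp.single i 1) := funext fun i => hρ s i
      rw [this, hps]
      simp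
      ring

/-- The leading part of an element of `wordSpan`. -/
theorem exists_leading_part {d : ℕ} {y : R} (hy : y ∈ wordSpan (F := F) hR x (d + 1)) :
    ∃ n : (ι →₀ ℕ) →₀ CliffordAlgebra.even (0 : QuadraticForm F (ι →₀ F)),
      (∀ α ∈ n.support, (Finsupp.toMultiset α).card = d) ∧
      y - n.sum (fun α ω => ((Finsupp.toMultiset α).toList.map x).prod * evenPartHom hR x ω) ∈
        wordSpan (F := F) hR x d := by
  classical
  have hadd : ∀ n n' : (ι →₀ ℕ) →₀ CliffordAlgebra.even (0 : QuadraticForm F (ι →₀ F)),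
      (n + n').sum (fun α ω =>
        ((Finsupp.toMultiset α).toList.map x).prod * evenPartHom hR x ω) =
      n.sum (fun α ω => ((Finsupp.toMultiset α).toList.map x).prod * evenPartHom hR x ω) +
      n'.sum (fun α ω => ((Finsupp.toMultiset α).toList.map x).prod * evenPartHom hR x ω) :=
    fun n n' => Finsupp.sum_add_index' (fun _ => by simp) fun _ _ _ => by rw [map_add, mul_add]
  induction hy using Submodule.span_induction with
  | zero => exact ⟨0, by simp⟩
  | add a b _ _ ha hb =>
    obtain ⟨n, hn, hns⟩ := ha
    obtain ⟨n', hn', hns'⟩ := hb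
    refine ⟨n + n', fun α hα => ?_, ?_⟩
    · rcases Finset.mem_union.1 (Finsupp.support_add hα) with h | h
      · exact hn α h
      · exact hn' α h
    · rw [hadd, add_sub_add_comm]
      exact add_mem hns hns'
  | smul a b _ hb =>
    obtain ⟨n, hn, hns⟩ := hb
    refine ⟨a • n, fun α hα => hn α (Finsupp.support_smul hα), ?_⟩
    rw [Finsupp.sum_smul_index' (fun _ => by simp)]
    simp only [map_smul, mul_smul_comm]
    rw [← Finsupp.smul_sum, ← smul_sub]
    exact Submodule.smul_mem _ _ hns
  | mem y hy =>
    obtain ⟨l, hl, ω, rfl⟩ := hy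
    rcases (Nat.lt_succ_iff.1 hl).lt_or_eq with h | h
    · exact ⟨0, by simp, by simpa using word_mul_mem_wordSpan h ω⟩
    · refine ⟨Finsupp.single (Multiset.toFinsupp (l : Multiset ι)) ω, fun α hα => ?_, ?_⟩
      · rw [Finset.mem_singleton.1 (Finsupp.support_single_subset hα), Multiset.toFinsupp_toMultiset]
        simpa using h
      · rw [Finsupp.sum_single_index (by simp), Multiset.toFinsupp_toMultiset, ← sub_mul, ← h]
        refine mul_evenPartHom_mem_wordSpan (prod_sub_prod_mem_wordSpan hR ?_) ω
        rw [← Multiset.coe_eq_coe, Multiset.coe_toList]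

theorem eq_zero_of_mem_wordSpan {d : ℕ} {y : R} (hy : y ∈ wordSpan (F := F) hR x d)
    (hρ : ∀ c : ι → F, ∃ ρ : R →ₐ[F] ExteriorAlgebra F (ι →₀ F),
      (∀ i, ρ (x i) = algebraMap F _ (c i) + ExteriorAlgebra.ι F (Finsupp.single i 1)) ∧
      ρ y = 0) : y = 0 := by
  induction d with
  | zero =>
    have : wordSpan (F := F) hR x 0 = ⊥ := by
      rw [wordSpan, Submodule.span_eq_bot]
      rintro _ ⟨l, hl, _⟩
      simp at hl
    rw [this] at hy
    simpa using hy
  | succ d ih =>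
    obtain ⟨n, hn, hns⟩ := exists_leading_part hy
    suffices h0 : n = 0 by
      refine ih ?_
      simpa [h0] using hns
    have hval := coeff_eq_zero_of_forall_sum_smul_eq_zero (F := F) n.support
      (fun α => (n α : ExteriorAlgebra F (ι →₀ F))) fun c => by
        rw [← Module.forall_dual_apply_eq_zero_iff F]
        intro φ
        choose ρ hρx hρy using fun s : F => hρ fun i => s * c i
        obtain ⟨p, hp, hps⟩ := exists_polynomial_of_mem_wordSpan c ρ hρx φ hns
        choose q hq hqs using fun α : ι →₀ ℕ =>
          apply_word c (Finsupp.toMultiset α).toList (n α : ExteriorAlgebra F (ι →₀ F)) φ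
        have hprod : ∀ α : ι →₀ ℕ, ((Finsupp.toMultiset α).toList.map c).prod =
            α.prod fun i k => c i ^ k := by
          intro α
          rw [← Multiset.prod_coe, ← Multiset.map_coe, Multiset.coe_toList,
            Finsupp.toMultiset_map, Finsupp.prod_toMultiset, Finsupp.prod_mapDomain_index
              (fun _ => pow_zero _) (fun _ _ _ => pow_add _ _ _)]
        -- Specialise at `s • c`: the coefficient of `s ^ d` sees only the leading part, because `q
        -- α` and `p` have degree below `d`.
        have hpoly : Polynomial.C (φ (∑ α ∈ n.support, (α.prod fun i k => c i ^ k) •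
            (n α : ExteriorAlgebra F (ι →₀ F)))) * Polynomial.X ^ d +
            ∑ α ∈ n.support, q α + p = 0 := by
          refine Polynomial.funext fun s => ?_
          have h1 := hps s
          rw [map_sub, hρy, zero_sub, Finsupp.sum, map_sum, map_neg, map_sum] at h1
          have h2 : ∀ α ∈ n.support, φ (ρ s (((Finsupp.toMultiset α).toList.map x).prod *
              evenPartHom hR x (n α))) =
              s ^ d * φ ((α.prod fun i k => c i ^ k) • (n α : ExteriorAlgebra F (ι →₀ F))) +
                (q α).eval s := by
            intro α hα
            have : (ρ s : R → _) ∘ x = fun i => algebraMap F _ (s * c i) +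
                ExteriorAlgebra.ι F (Finsupp.single i 1) := funext fun i => hρx s i
            rw [map_mul, apply_evenPartHom hR x _ (ρ s) (hρx s), map_list_prod, List.map_map,
              this, hqs, Multiset.length_toList, hn α hα, hprod, map_smul, smul_eq_mul]
          rw [Finset.sum_congr rfl h2, Finset.sum_add_distrib, ← Finset.mul_sum, ← map_sum] at h1
          simp only [Polynomial.eval_add, Polynomial.eval_mul, Polynomial.eval_C,
            Polynomial.eval_pow, Polynomial.eval_X, Polynomial.eval_finsetSum,
            Polynomial.eval_zero, ← h1]
          ring
        have hcoeff := congrArg (Polynomial.coeff · d) hpoly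
        simp only [Polynomial.coeff_add, Polynomial.coeff_C_mul, Polynomial.coeff_X_pow_self,
          mul_one, Polynomial.finsetSum_coeff, hp d le_rfl, add_zero, Polynomial.coeff_zero]
          at hcoeff
        rwa [Finset.sum_eq_zero fun α hα => hq α d (by
          rw [Multiset.length_toList, hn α hα]), add_zero] at hcoeff
    ext α : 1
    by_cases hα : α ∈ n.support
    · exact Subtype.ext (hval α hα)
    · simpa using hα

end Filtration

/-- The identities of the exterior algebra follow from `[[a, b], c] = 0`. -/
theorem lift_eq_zero_of_lie_lie [CharZero F] (hR : ∀ a b c : R, ⁅⁅a, b⁆, c⁆ = 0) (x : ι → R)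
    (f : FreeAlgebra F ι)
    (hf : ∀ a : ι → ExteriorAlgebra F (ι →₀ F), FreeAlgebra.lift F a f = 0) :
    FreeAlgebra.lift F x f = 0 := by
  -- Adjoin all specialisations as extra coordinates; the product remains Lie nilpotent of class
  -- two.
  let t : (ι → F) → ι → ExteriorAlgebra F (ι →₀ F) := fun c i =>
    algebraMap F _ (c i) + ExteriorAlgebra.ι F (Finsupp.single i 1)
  let x' : ι → R × ((ι → F) → ExteriorAlgebra F (ι →₀ F)) := fun i => (x i, fun c => t c i)
  have hfst : FreeAlgebra.lift F x = (AlgHom.fst F R _).comp (FreeAlgebra.lift F x') := by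
    ext i
    simp [x']
  have hsnd : ∀ c, FreeAlgebra.lift F (t c) = ((Pi.evalAlgHom F _ c).comp
      (AlgHom.snd F R _)).comp (FreeAlgebra.lift F x') := by
    intro c
    ext i
    simp [x']
  have hR' : ∀ a b c : R × ((ι → F) → ExteriorAlgebra F (ι →₀ F)), ⁅⁅a, b⁆, c⁆ = 0 :=
    fun a b c => Prod.ext (hR a.1 b.1 c.1)
      (funext fun k => exterior_lie_lie (a.2 k) (b.2 k) (c.2 k))
  obtain ⟨d, hd⟩ := exists_lift_mem_wordSpan (F := F) (hR := hR') (x := x') f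
  have h0 := eq_zero_of_mem_wordSpan hd fun c =>
    ⟨(Pi.evalAlgHom F _ c).comp (AlgHom.snd F R _), fun i => rfl, by
      rw [← hf (t c), hsnd c]
      rfl⟩
  rw [hfst, AlgHom.comp_apply, h0, map_zero]

end LieNilpotent

/-! ### T-ideals and graded substitutions. -/

section TIdeals

variable {F : Type*} [Field F] {G : Type*} [AddCommGroup G]

theorem one_mem_freeComponent : (1 : FreeGr F G) ∈ freeComponent F (0 : G) :=
  Submodule.subset_span ⟨[], by simp, by simp⟩

theorem X_mem_freeComponent (g : G) (i : ℕ) : X F g i ∈ freeComponent F g :=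
  Submodule.subset_span ⟨[(g, i)], by simp, by simp [X]⟩

theorem mul_mem_freeComponent {g h : G} {a b : FreeGr F G} (ha : a ∈ freeComponent F g)
    (hb : b ∈ freeComponent F h) : a * b ∈ freeComponent F (g + h) := by
  have h2 := Submodule.mul_mem_mul ha hb
  rw [freeComponent, freeComponent, Submodule.span_mul_span] at h2
  refine Submodule.span_mono ?_ h2
  rintro _ ⟨_, ⟨w, hw, rfl⟩, _, ⟨w', hw', rfl⟩, rfl⟩
  exact ⟨w ++ w', by simp [hw, hw'], by simp⟩

theorem lift_mem_of_mem_freeComponent {R : Type*} [Ring R] [Algebra F R]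
    {A : G → Submodule F R} (h1 : 1 ∈ A 0)
    (hmul : ∀ g h, ∀ a ∈ A g, ∀ b ∈ A h, a * b ∈ A (g + h)) {a : G × ℕ → R}
    (ha : ∀ g i, a (g, i) ∈ A g) {g : G} {f : FreeGr F G} (hf : f ∈ freeComponent F g) :
    FreeAlgebra.lift F a f ∈ A g := by
  have hword : ∀ w : List (G × ℕ),
      FreeAlgebra.lift F a (w.map (FreeAlgebra.ι F)).prod ∈ A (w.map Prod.fst).sum := by
    intro w
    induction w with
    | nil => simpa using h1
    | cons p w ih => simpa using hmul _ _ _ (ha p.1 p.2) _ ih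
  have hle : freeComponent F g ≤ (A g).comap (FreeAlgebra.lift F a).toLinearMap := by
    refine Submodule.span_le.2 ?_
    rintro _ ⟨w, rfl, rfl⟩
    exact hword w
  exact hle hf

theorem isGradedEndo_lift {a : G × ℕ → FreeGr F G} (ha : ∀ g i, a (g, i) ∈ freeComponent F g) :
    IsGradedEndo F (FreeAlgebra.lift F a) := fun _ _ hf =>
  lift_mem_of_mem_freeComponent one_mem_freeComponent
    (fun _ _ _ ha _ hb => mul_mem_freeComponent ha hb) ha hf

theorem isTIdeal_gradedIdentities {R : Type*} [Ring R] [Algebra F R]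
    {A : G → Submodule F R} (h1 : 1 ∈ A 0)
    (hmul : ∀ g h, ∀ a ∈ A g, ∀ b ∈ A h, a * b ∈ A (g + h)) :
    IsTIdeal F (gradedIdentities A) := by
  intro φ hφ f hf
  rw [mem_gradedIdentities] at hf ⊢
  intro a ha
  have : (FreeAlgebra.lift F a).comp φ =
      FreeAlgebra.lift F fun q => FreeAlgebra.lift F a (φ (X F q.1 q.2)) := by
    ext q
    simp [X]
  rw [← AlgHom.comp_apply, this]
  exact hf _ fun g i => lift_mem_of_mem_freeComponent h1 hmul ha (hφ g _ (X_mem_freeComponent g i))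

theorem mem_tIdealSpan {s : Set (FreeGr F G)} {f : FreeGr F G} :
    f ∈ tIdealSpan F s ↔ ∀ I : TwoSidedIdeal (FreeGr F G), IsTIdeal F I → (∀ f ∈ s, f ∈ I) →
      f ∈ I := by
  simp [tIdealSpan, TwoSidedIdeal.mem_sInf]

theorem span_freeComponent_eq_top :
    Submodule.span F {f : FreeGr F G | ∃ g, f ∈ freeComponent F g} = ⊤ := by
  rw [eq_top_iff]
  intro f _
  have hid : FreeAlgebra.lift F (FreeAlgebra.ι F) f = f := by
    have : FreeAlgebra.lift F (FreeAlgebra.ι F : G × ℕ → FreeGr F G) = AlgHom.id F _ := by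
      ext
      simp
    rw [this, AlgHom.id_apply]
  rw [← hid]
  refine lift_mem_of_left_mul_mem _
    (Submodule.span F {f : FreeGr F G | ∃ g, f ∈ freeComponent F g})
    (Submodule.subset_span ⟨0, one_mem_freeComponent⟩) ?_ f
  intro q n hn
  induction hn using Submodule.span_induction with
  | zero => simp
  | add a b _ _ ha hb => rw [mul_add]; exact add_mem ha hb
  | smul c a _ ha => rw [mul_smul_comm]; exact Submodule.smul_mem _ c ha
  | mem a ha =>
    obtain ⟨g, hg⟩ := ha
    exact Submodule.subset_span ⟨_, mul_mem_freeComponent (X_mem_freeComponent q.1 q.2) hg⟩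

/-- Graded endomorphisms reach homogeneous arguments; trilinearity then gives arbitrary ones. -/
theorem lie_lie_mem_of_isTIdeal {I : TwoSidedIdeal (FreeGr F G)} (hI : IsTIdeal F I)
    (h : ∀ p q r : G, ⁅⁅X F p 1, X F q 2⁆, X F r 3⁆ ∈ I) (a b c : FreeGr F G) :
    ⁅⁅a, b⁆, c⁆ ∈ I := by
  classical
  have hhom : ∀ p q r : G, ∀ a ∈ freeComponent F p, ∀ b ∈ freeComponent F q,
      ∀ c ∈ freeComponent F r, ⁅⁅a, b⁆, c⁆ ∈ I := by
    intro p q r a ha b hb c hc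
    have := hI (FreeAlgebra.lift F fun s : G × ℕ =>
      if s = (p, 1) then a else if s = (q, 2) then b else if s = (r, 3) then c else X F s.1 s.2)
      (isGradedEndo_lift fun g i => by
        split_ifs with h1 h2 h3
        · rwa [show g = p from (Prod.ext_iff.1 h1).1]
        · rwa [show g = q from (Prod.ext_iff.1 h2).1]
        · rwa [show g = r from (Prod.ext_iff.1 h3).1]
        · exact X_mem_freeComponent g i) _ (h p q r)
    simpa [Ring.lie_def, X] using this
  have hsmul : ∀ (s : F), ∀ y ∈ I, s • y ∈ I := fun s y hy => by
    rw [Algebra.smul_def]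
    exact I.mul_mem_left _ _ hy
  have ext : ∀ T : FreeGr F G →ₗ[F] FreeGr F G, (∀ g, ∀ y ∈ freeComponent F g, T y ∈ I) →
      ∀ y, T y ∈ I := by
    intro T hT y
    have hy : y ∈ Submodule.span F {f : FreeGr F G | ∃ g, f ∈ freeComponent F g} := by
      rw [span_freeComponent_eq_top]
      trivial
    induction hy using Submodule.span_induction with
    | zero => rw [map_zero]; exact I.zero_mem
    | add a b _ _ ha hb => rw [map_add]; exact I.add_mem ha hb
    | smul s a _ ha => rw [map_smul]; exact hsmul s _ ha
    | mem a ha => exact hT _ a ha.choose_spec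
  let ad : FreeGr F G → FreeGr F G →ₗ[F] FreeGr F G := fun u =>
    LinearMap.mulRight F u - LinearMap.mulLeft F u
  let ad' : FreeGr F G → FreeGr F G →ₗ[F] FreeGr F G := fun u =>
    LinearMap.mulLeft F u - LinearMap.mulRight F u
  refine ext (ad' ⁅a, b⁆) (fun r c hc => ?_) c
  refine ext ((ad c).comp (ad' a)) (fun q b hb => ?_) b
  exact ext ((ad c).comp (ad b)) (fun p a ha => hhom p q r a ha b hb c hc) a

end TIdeals

/-! ### From vanishing evaluations to membership in the T-ideals. -/

section MainResults

variable {F : Type*} [Field F]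

theorem identitiesV1_le_gradedIdentities (A : ℤ → Submodule F (E F)) [SetLike.GradedMonoid A] :
    identitiesV1 F ≤ gradedIdentities A := by
  intro f hf
  rw [identitiesV1, mem_tIdealSpan] at hf
  refine hf _ (isTIdeal_gradedIdentities SetLike.GradedOne.one_mem
    fun _ _ _ ha _ hb => SetLike.mul_mem_graded ha hb) ?_
  rintro _ ⟨p, q, r, rfl⟩
  rw [mem_gradedIdentities]
  intro a _
  have := exterior_lie_lie (a (p, 1)) (a (q, 2)) (a (r, 3))
  simpa [Ring.lie_def, X] using this

theorem mem_of_lift_mkₐ_eq_zero {G : Type*} {I : TwoSidedIdeal (FreeGr F G)} {f : FreeGr F G}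
    (h : FreeAlgebra.lift F (fun q => (I.ringCon.mkₐ F) (FreeAlgebra.ι F q)) f = 0) : f ∈ I := by
  have hmk : FreeAlgebra.lift F (fun q => (I.ringCon.mkₐ F) (FreeAlgebra.ι F q)) =
      I.ringCon.mkₐ F := by
    ext q
    simp
  rw [hmk] at h
  rw [TwoSidedIdeal.mem_iff]
  exact (RingCon.eq _).1 h

theorem lift_X_mem_of_isTIdeal {I : TwoSidedIdeal (FreeGr F ℤ)} (hI : IsTIdeal F I) (i j : ℕ)
    {f : FreeGr F ℤ} (hf : f ∈ I) :
    FreeAlgebra.lift F (fun s : ℤ × ℕ => X F s.1 (if s.2 = 1 then i else if s.2 = 2 then j else s.2))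
      f ∈ I :=
  hI _ (isGradedEndo_lift (a := fun s : ℤ × ℕ =>
    X F s.1 (if s.2 = 1 then i else if s.2 = 2 then j else s.2))
      fun g _ => X_mem_freeComponent g _) f hf

theorem exists_linearIndependent_of_not_finiteDimensional {V : Type*} [AddCommGroup V] [Module F V]
    {M : Submodule F V} (hM : ¬ FiniteDimensional F M) (σ : Type*) [Countable σ] :
    ∃ v : σ → V, LinearIndependent F v ∧ ∀ i, v i ∈ M := by
  let b := Module.Free.chooseBasis F M
  have hinf : Infinite (Module.Free.ChooseBasisIndex F M) := by
    by_contra hnot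
    have := not_infinite_iff_finite.1 hnot
    exact hM (Module.Finite.of_basis b)
  obtain ⟨k, hk⟩ := exists_injective_nat σ
  exact ⟨fun i => b (Infinite.natEmbedding _ (k i)), (b.linearIndependent.comp _
    ((Infinite.natEmbedding _).injective.comp hk)).map' M.subtype M.ker_subtype,
    fun i => (b _).2⟩

variable [CharZero F]

theorem mem_identitiesV1_of_forall_lift_eq_zero {f : FreeGr F ℤ}
    (hf : ∀ a : ℤ × ℕ → E F, FreeAlgebra.lift F a f = 0) : f ∈ identitiesV1 F := by
  rw [identitiesV1, mem_tIdealSpan]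
  intro I hI hgen
  refine mem_of_lift_mkₐ_eq_zero (lift_eq_zero_of_lie_lie ?_ _ f ?_)
  · intro a b c
    obtain ⟨a, rfl⟩ := RingCon.mkₐ_surjective (α := F) I.ringCon a
    obtain ⟨b, rfl⟩ := RingCon.mkₐ_surjective (α := F) I.ringCon b
    obtain ⟨c, rfl⟩ := RingCon.mkₐ_surjective (α := F) I.ringCon c
    have := lie_lie_mem_of_isTIdeal hI (fun p q r => hgen _ ⟨p, q, r, rfl⟩) a b c
    rw [TwoSidedIdeal.mem_iff] at this
    have := (RingCon.eq _).2 this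
    simp only [Ring.lie_def, ← map_mul, ← map_sub]
    exact this
  · intro a
    -- A bijection of `ℤ × ℕ` with `ℕ` transports the generic exterior algebra into `E`.
    let e := Finsupp.domLCongr (M := F) (R := F) (nonempty_denumerable_iff.2
      ⟨inferInstance, inferInstance⟩ : Nonempty (Denumerable (ℤ × ℕ))).some.eqv
    have hinj : Function.Injective (ExteriorAlgebra.map (e : (ℤ × ℕ →₀ F) →ₗ[F] (ℕ →₀ F))) :=
      ExteriorAlgebra.map_injective_field (LinearMap.ker_eq_bot.2 e.injective)
    apply hinj
    have hcomp : (ExteriorAlgebra.map (e : (ℤ × ℕ →₀ F) →ₗ[F] (ℕ →₀ F))).comp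
        (FreeAlgebra.lift F a) = FreeAlgebra.lift F fun q =>
          ExteriorAlgebra.map (e : (ℤ × ℕ →₀ F) →ₗ[F] (ℕ →₀ F)) (a q) := by
      ext q
      simp
    rw [← AlgHom.comp_apply, hcomp, hf, map_zero]

/-- If infinitely many independent vectors of `L` have the same odd degree, then the graded
identities with even variables specialised at scalars generate no more than `identitiesV2`. -/
theorem mem_identitiesV2_of_forall_lift_eq_zero {A : ℤ → Submodule F (E F)} {m : ℤ} (hm : Odd m)
    (hA1 : (1 : E F) ∈ A 0) (hfin : ¬ FiniteDimensional F ↥(L F ⊓ A m)) {f : FreeGr F ℤ}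
    (hf : ∀ d : ℤ × ℕ → E F,
      (∀ q : ℤ × ℕ, d q ∈ ⨆ r : {r : ℤ // q.1 - r ∈ {h : ℤ | Even h}}, A r.1) →
        FreeAlgebra.lift F d f = 0) : f ∈ identitiesV2 F := by
  classical
  rw [identitiesV2, mem_tIdealSpan]
  intro I hI hgen
  have hrelE : ∀ p q : ℤ × ℕ, (Even p.1 ∨ Even q.1) →
      FreeAlgebra.ι F p * FreeAlgebra.ι F q - FreeAlgebra.ι F q * FreeAlgebra.ι F p ∈ I := by
    intro p q hpq
    have := lift_X_mem_of_isTIdeal hI p.2 q.2 (hgen _ (Or.inl ⟨p.1, q.1, hpq, rfl⟩))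
    simpa [Ring.lie_def, X] using this
  have hrelO : ∀ p q : ℤ × ℕ, ¬ Even p.1 → ¬ Even q.1 →
      FreeAlgebra.ι F p * FreeAlgebra.ι F q + FreeAlgebra.ι F q * FreeAlgebra.ι F p ∈ I := by
    intro p q hp hq
    have := lift_X_mem_of_isTIdeal hI p.2 q.2 (hgen _ (Or.inr ⟨p.1, q.1,
      Int.not_even_iff_odd.1 hp, Int.not_even_iff_odd.1 hq, rfl⟩))
    simpa [X] using this
  refine mem_of_lift_mkₐ_eq_zero (lift_eq_zero_of_supercommutative
    (ev := fun q : ℤ × ℕ => Even q.1) _ ?_ ?_ f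
    (fun c q => if h : Even q.1 then algebraMap F _ (c ⟨q, h⟩) else
      ExteriorAlgebra.ι F (Finsupp.single ⟨q, h⟩ 1)) ?_ ?_ ?_)
  · intro q hq r
    obtain ⟨r, rfl⟩ := RingCon.mkₐ_surjective (α := F) I.ringCon r
    induction r using FreeAlgebra.induction with
    | grade0 s => rw [AlgHom.commutes]; exact Algebra.commute_algebraMap_right s _
    | grade1 p =>
      have := hrelE q p (Or.inl hq)
      rw [TwoSidedIdeal.mem_iff] at this
      have := (RingCon.eq _).2 this
      rw [Commute, SemiconjBy, ← sub_eq_zero, ← map_mul, ← map_mul, ← map_sub]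
      exact this
    | mul a b ha hb => rw [map_mul]; exact ha.mul_right hb
    | add a b ha hb => rw [map_add]; exact ha.add_right hb
  · intro p q hp hq
    have := hrelO p q hp hq
    rw [TwoSidedIdeal.mem_iff] at this
    have := (RingCon.eq _).2 this
    rw [← map_mul, ← map_mul, ← map_add]
    exact this
  · intro c i
    simp [i.2]
  · intro c i
    simp [i.2]
  · intro c
    -- Independent vectors of degree `m` embed the exterior algebra on the odd variables in `E`.
    -- Scalars have degree `0` and `m` is odd, so degrees agree modulo `2`.
    obtain ⟨v, hv, hvM⟩ := exists_linearIndependent_of_not_finiteDimensional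
      (not_finiteDimensional_comap_ι hfin) {q : ℤ × ℕ // ¬ Even q.1}
    apply ExteriorAlgebra.map_injective_field (LinearMap.ker_eq_bot.2 hv)
    have hcomp : ∀ t, (ExteriorAlgebra.map (Finsupp.linearCombination F v)).comp
        (FreeAlgebra.lift F t) = FreeAlgebra.lift F fun q : ℤ × ℕ =>
          ExteriorAlgebra.map (Finsupp.linearCombination F v) (t q) := by
      intro t
      ext q
      simp
    rw [map_zero, ← AlgHom.comp_apply, hcomp]
    refine hf _ fun q => ?_
    by_cases hq : Even q.1
    · refine Submodule.mem_iSup_of_mem (p := fun r : {r : ℤ // q.1 - r ∈ {h : ℤ | Even h}} => A r.1)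
        ⟨0, by simpa using hq⟩ ?_
      simpa [hq, Algebra.algebraMap_eq_smul_one] using Submodule.smul_mem _ _ hA1
    · refine Submodule.mem_iSup_of_mem (p := fun r : {r : ℤ // q.1 - r ∈ {h : ℤ | Even h}} => A r.1)
        ⟨m, (Int.not_even_iff_odd.1 hq).sub_odd hm⟩ ?_
      simpa [hq] using hvM ⟨q, hq⟩

end MainResults

end GradedGrassmann

theorem theorem5p3 (F : Type*) [Field F] [CharZero F]
    (A : ℤ → Submodule F (GradedGrassmann.E F)) [GradedAlgebra A] :
    (∀ S : Set ℕ, S.Infinite →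
      (∀ i ∈ S, ∃ r : ℤ, GradedGrassmann.e F i ∈ A r) →
      GradedGrassmann.IsCentral S
        (GradedGrassmann.restrictGrading (GradedGrassmann.subGrassmann F S) A) →
      GradedGrassmann.gradedIdentities A ≤
        TwoSidedIdeal.comap (GradedGrassmann.reduceMod2 F)
          (GradedGrassmann.gradedIdentities (GradedGrassmann.inducedMod2
            (GradedGrassmann.restrictGrading (GradedGrassmann.subGrassmann F S) A)))) ∧
    (∀ m n : ℤ, m < 0 → 0 < n → Int.gcd m n = 1 →
      ¬ FiniteDimensional F ↥(GradedGrassmann.L F ⊓ A m) →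
      ¬ FiniteDimensional F ↥(GradedGrassmann.L F ⊓ A n) →
      (Even (m * n) ∧
          GradedGrassmann.gradedIdentities A = GradedGrassmann.identitiesV1 F) ∨
        (Odd (m * n) ∧
          GradedGrassmann.gradedIdentities A ≤ GradedGrassmann.identitiesV2 F)) := by
  refine ⟨fun S _ _ hS => GradedGrassmann.gradedIdentities_le_comap_inducedMod2 A hS,
    fun m n hm hn hmn hLm hLn => ?_⟩
  rcases Int.even_or_odd (m * n) with h | h
  · refine Or.inl ⟨h, le_antisymm (fun f hf => ?_)
      (GradedGrassmann.identitiesV1_le_gradedIdentities A)⟩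
    refine GradedGrassmann.mem_identitiesV1_of_forall_lift_eq_zero fun a => ?_
    -- Every degree is available, so `f` vanishes on all of `E`.
    refine GradedGrassmann.lift_eq_zero_of_mem_gradedIdentities (H := Set.univ)
      (fun k _ => ?_) hf a fun q => ?_
    · obtain ⟨p, q, h1, h2, h3⟩ := GradedGrassmann.exists_nat_combination hm hn hmn k (Or.inr h)
      exact GradedGrassmann.exists_central_of_degrees hLm hLn h1 h2 h3
    · have htop : ⨆ r : ℤ, A r = ⊤ :=
        (DirectSum.Decomposition.isInternal A).submodule_iSup_eq_top
      have hle : ⨆ r : ℤ, A r ≤ ⨆ r : {r : ℤ // q.1 - r ∈ Set.univ}, A r.1 :=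
        iSup_le fun r => le_iSup (fun r : {r : ℤ // q.1 - r ∈ Set.univ} => A r.1)
          ⟨r, Set.mem_univ _⟩
      exact hle (htop ▸ Submodule.mem_top)
  · refine Or.inr ⟨h, fun f hf => ?_⟩
    refine GradedGrassmann.mem_identitiesV2_of_forall_lift_eq_zero (Int.odd_mul.1 h).1
      SetLike.GradedOne.one_mem hLm fun d hd => ?_
    refine GradedGrassmann.lift_eq_zero_of_mem_gradedIdentities (H := {h | Even h})
      (fun k hk => ?_) hf d hd
    obtain ⟨p, q, h1, h2, h3⟩ := GradedGrassmann.exists_nat_combination hm hn hmn k (Or.inl hk)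
    exact GradedGrassmann.exists_central_of_degrees hLm hLn h1 h2 h3
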